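/- Let $\ell\in\frac12\mathbb{N}$ with $\ell>0$. Index the rows and columns of $(2\ell+1)\times(2\ell+1)$ matrices by $0,1,\dots,2\ell$, let $E_{i,j}$ be the elementary matrices, with $E_{i,j}=0$ if $i$ or $j$ is not in $\{0,\dots,2\ell\}$, and write $\mathrm{Mat}$ for the algebra of complex $(2\ell+1)\times(2\ell+1)$ matrices. Let $W$ be the matrix weight on $(-1,1)$ given for $0\le n\le m\le 2\ell$ by $$W(x)_{n,m}=(1-x)^{\frac12}(1+x)^{\frac12}\,\frac{2\ell+1}{n+1}\,\frac{(2\ell-m)!\,m!}{(2\ell)!}\sum_{t=0}^{m}(-1)^{m-t}\,\frac{(n-2\ell)_{m-t}}{(n+2)_{m-t}}\,\frac{(2\ell+2-t)_t}{t!}\,U_{n+m-2t}(x),$$ and $W(x)_{n,m}=W(x)_{m,n}$ for $n>m$. Here $(a)_k=a(a+1)\cdots(a+k-1)$, and $U_k$, $k\in\mathbb{Z}$, are the Chebyshev polynomials of the second kind, extended to negative indices by their three-term recurrence ($U_{-1}=0$, $U_{-k-2}=-U_k$). For $P,Q\in\mathrm{Mat}[x]$ put $\langle P,Q\rangle=\int_{-1}^1P(x)W(x)Q(x)^*\,dx$.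 A sequence $(R_n)_{n\ge0}$ in $\mathrm{Mat}[x]$ is called orthogonal with respect to $W$ if $R_n$ has degree $n$ and nonsingular leading coefficient and $\langle R_n,R_m\rangle=0$ for $n\ne m$. Let $(P_n)_{n\ge0}$ be the sequence of monic orthogonal polynomials with respect to $W$. A right-hand differential operator $D=\sum_i\partial^iF_i(x)$ acts by $PD=\sum_i\frac{d^iP}{dx^i}F_i$. Let $\mathcal{D}$ be the set of such operators with $F_i\in\mathrm{Mat}[x]$, $\deg F_i\le i$. An operator $D\in\mathcal{D}$ is symmetric with respect to $W$ if $\langle PD,Q\rangle=\langle P,QD\rangle$ for all $P,Q\in\mathrm{Mat}[x]$. Let $\mathcal{D}(W)$ be the set of $D\in\mathcal{D}$ such that for every sequence $(R_n)$ orthogonal with respect to $W$ there are $\Gamma_n\in\mathrm{Mat}$ with $R_nD=\Gamma_nR_n$ for all $n\ge0$. **Theorem.** Let $E=\frac{d}{dx}A_1(x)+A_0$, where $$A_1(x)=\sum_{i=0}^{2\ell}\frac{2\ell-i}{2\ell}E_{i,i+1}-\sum_{i=0}^{2\ell}x\,\frac{\ell-i}{\ell}E_{i,i}-\sum_{i=0}^{2\ell}\frac{i}{2\ell}E_{i,i-1},\qquad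 A_0=\sum_{i=0}^{2\ell}\frac{(2\ell+2)(i-2\ell)}{2\ell}E_{i,i}.$$ Then $E$ is symmetric with respect to $W$; hence $E\in\mathcal{D}(W)$. Moreover, for every integer $n\ge0$, $$P_n(x)E=\Lambda_n(E)P_n(x),\qquad \Lambda_n(E)=\sum_{i=0}^{2\ell}\left(-\frac{n(\ell-i)}{\ell}+\frac{(2\ell+2)(i-2\ell)}{2\ell}\right)E_{i,i}.$$ -/

import Mathlib

open Polynomial

noncomputable section

namespace MVOP

/-! ### Matrix valued orthogonal polynomials on `(-1, 1)` -/

section General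

variable {ι : Type} [Fintype ι] [DecidableEq ι]

/-- The value `P(x)` at a real point `x` of a polynomial with matrix coefficients. -/
def evalAt (P : (Matrix ι ι ℂ)[X]) (x : ℝ) : Matrix ι ι ℂ :=
  P.eval (algebraMap ℂ (Matrix ι ι ℂ) (x : ℂ))

/-- The matrix valued sesquilinear form `⟨P, Q⟩ = ∫_{-1}^{1} P(x) W(x) Q(x)^* dx`
(the integral is taken entrywise). -/
def pairing (W : ℝ → Matrix ι ι ℂ) (P Q : (Matrix ι ι ℂ)[X]) : Matrix ι ι ℂ :=
  Matrix.of fun i j =>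
    ∫ x in (-1 : ℝ)..1, (evalAt P x * W x * (evalAt Q x).conjTranspose) i j

/-- A sequence of matrix valued orthogonal polynomials for `W`: `R n` has degree `n` and
nonsingular leading coefficient, and `⟨R n, R m⟩ = 0` for `n ≠ m`. -/
structure IsOrthogonalSeq (W : ℝ → Matrix ι ι ℂ) (R : ℕ → (Matrix ι ι ℂ)[X]) : Prop where
  natDegree_eq : ∀ n, (R n).natDegree = n
  isUnit_leadingCoeff : ∀ n, IsUnit (R n).leadingCoeff
  orthogonal : ∀ n m, n ≠ m → pairing W (R n) (R m) = 0

/-- A sequence of monic matrix valued orthogonal polynomials for `W`. -/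
structure IsMonicOrthogonalSeq (W : ℝ → Matrix ι ι ℂ) (P : ℕ → (Matrix ι ι ℂ)[X]) : Prop
    extends IsOrthogonalSeq W P where
  monic : ∀ n, (P n).Monic

/-- A right-hand differential operator `∑ i, ∂^i F_i(x)` with matrix polynomial coefficients,
given by its finitely supported family of coefficients `i ↦ F_i`. -/
abbrev RightDiffOp (ι : Type) [Fintype ι] [DecidableEq ι] : Type := ℕ →₀ (Matrix ι ι ℂ)[X]

/-- The right action `P D = ∑ i, (∂^i P) F_i`. -/
def actRight (P : (Matrix ι ι ℂ)[X]) (D : RightDiffOp ι) : (Matrix ι ι ℂ)[X] :=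
  D.sum fun i F => (derivative^[i] P) * F

/-- The operators `∑ i, ∂^i F_i` with `deg F_i ≤ i`. -/
def opAlgebra (ι : Type) [Fintype ι] [DecidableEq ι] : Set (RightDiffOp ι) :=
  {D | ∀ i, (D i).degree ≤ i}

/-- `D` belongs to the class of operators with `deg F_i ≤ i` and is symmetric with respect to
`W`: `⟨P D, Q⟩ = ⟨P, Q D⟩` for all matrix polynomials `P`, `Q`. -/
def IsSymmetricOp (W : ℝ → Matrix ι ι ℂ) (D : RightDiffOp ι) : Prop :=
  D ∈ opAlgebra ι ∧
    ∀ P Q : (Matrix ι ι ℂ)[X], pairing W (actRight P D) Q = pairing W P (actRight Q D)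

/-- `𝒟(W)`: the operators (with `deg F_i ≤ i`) having the orthogonal polynomials for `W` as
eigenfunctions, `R_n D = Γ_n R_n` with constant matrices `Γ_n`, for any sequence of orthogonal
polynomials `R_n`. -/
def eigenAlgebra (W : ℝ → Matrix ι ι ℂ) : Set (RightDiffOp ι) :=
  {D | D ∈ opAlgebra ι ∧ ∀ R : ℕ → (Matrix ι ι ℂ)[X], IsOrthogonalSeq W R →
    ∃ Γ : ℕ → Matrix ι ι ℂ, ∀ n, actRight (R n) D = C (Γ n) * R n}

end General

/-! ### The weight; throughout `N = 2ℓ`, so that `ℓ ∈ ½ℕ` and `n, m ∈ {0, …, 2ℓ}` -/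

/-- The coefficient
`c(n,m,t) = (2ℓ+1)/(n+1) · (2ℓ-m)! m!/(2ℓ)! · (-1)^(m-t) (n-2ℓ)_(m-t)/(n+2)_(m-t)
  · (2ℓ+2-t)_t/t!`,
where `(a)_k` is the rising factorial. It is used for `n, m ≤ N = 2ℓ` and `t ≤ m` only. -/
def weightCoeff (N n m t : ℕ) : ℝ :=
  ((N : ℝ) + 1) / ((n : ℝ) + 1)
    * (((N - m).factorial : ℝ) * (m.factorial : ℝ) / (N.factorial : ℝ))
    * ((-1) ^ (m - t)
      * ((ascPochhammer ℝ (m - t)).eval ((n : ℝ) - N)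
          / (ascPochhammer ℝ (m - t)).eval ((n : ℝ) + 2))
      * ((ascPochhammer ℝ t).eval ((N : ℝ) + 2 - t) / (t.factorial : ℝ)))

/-- `∑_{t=0}^m c(n,m,t) U_{n+m-2t}(x)`, with `U_k` the Chebyshev polynomials of the second kind
(for `k < 0` given by the recurrence, `U_{-1} = 0`, `U_{-k-2} = -U_k`). -/
def weightEntry (N n m : ℕ) (x : ℝ) : ℝ :=
  ∑ t ∈ Finset.range (m + 1),
    weightCoeff N n m t * (Chebyshev.U ℝ ((n : ℤ) + (m : ℤ) - 2 * (t : ℤ))).eval x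

/-- The matrix `Z(x)`: the entries with `n ≤ m` are given by the expansion in Chebyshev
polynomials, the others by symmetry. -/
def matrixZ (N : ℕ) (x : ℝ) : Matrix (Fin (N + 1)) (Fin (N + 1)) ℝ :=
  Matrix.of fun n m => if n ≤ m then weightEntry N n m x else weightEntry N m n x

/-- The weight `W(x) = (1-x)^{1/2} (1+x)^{1/2} Z(x)`. -/
def weight (N : ℕ) (x : ℝ) : Matrix (Fin (N + 1)) (Fin (N + 1)) ℂ :=
  (Real.sqrt (1 - x) * Real.sqrt (1 + x)) • (matrixZ N x).map (fun r : ℝ => (r : ℂ))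

/-! ### The first order differential operator -/

/-- The elementary matrix `E_{i,j}`, which is zero if `i` or `j` is not in `{0, …, N}`. -/
def elem (N : ℕ) (i j : ℤ) : Matrix (Fin (N + 1)) (Fin (N + 1)) ℂ :=
  Matrix.of fun a b => if ((a : ℕ) : ℤ) = i ∧ ((b : ℕ) : ℤ) = j then 1 else 0

/-- `A₁(x) = ∑ (2ℓ-i)/(2ℓ) E_{i,i+1} - ∑ x (ℓ-i)/ℓ E_{i,i} - ∑ i/(2ℓ) E_{i,i-1}`. -/
def coeffA1 (N : ℕ) : (Matrix (Fin (N + 1)) (Fin (N + 1)) ℂ)[X] :=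
  ∑ i ∈ Finset.range (N + 1), C ((((N : ℂ) - i) / N) • elem N i (i + 1))
    - ∑ i ∈ Finset.range (N + 1), X * C ((((N : ℂ) / 2 - i) / ((N : ℂ) / 2)) • elem N i i)
    - ∑ i ∈ Finset.range (N + 1), C (((i : ℂ) / N) • elem N i (i - 1))

/-- `A₀ = ∑ (2ℓ+2)(i-2ℓ)/(2ℓ) E_{i,i}`. -/
def coeffA0 (N : ℕ) : Matrix (Fin (N + 1)) (Fin (N + 1)) ℂ :=
  ∑ i ∈ Finset.range (N + 1), ((((N : ℂ) + 2) * ((i : ℂ) - N)) / N) • elem N i i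

/-- The operator `E = ∂ A₁(x) + A₀`. -/
def opE (N : ℕ) : RightDiffOp (Fin (N + 1)) :=
  Finsupp.single 1 (coeffA1 N) + Finsupp.single 0 (C (coeffA0 N))

/-- `Λ_n(E) = ∑ (-n(ℓ-i)/ℓ + (2ℓ+2)(i-2ℓ)/(2ℓ)) E_{i,i}`. -/
def eigenvalueE (N n : ℕ) : Matrix (Fin (N + 1)) (Fin (N + 1)) ℂ :=
  ∑ i ∈ Finset.range (N + 1),
    (-((n : ℂ) * ((N : ℂ) / 2 - i)) / ((N : ℂ) / 2)
      + (((N : ℂ) + 2) * ((i : ℂ) - N)) / N) • elem N i i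

end MVOP

end

noncomputable section

namespace MVOP

/-! ### Bezoutian sums of Chebyshev polynomials -/

/-! Write N = 2ℓ and w = √(1-x²). By integration by parts, ∂A₁ + A₀ is symmetric once A₁W is
anti-Hermitian (`coeffA1_mul_weight`), (A₁W)' = A₀W - WA₀^* on (-1,1)
(`hasDerivAt_coeffA1_mul_weight`), and A₁W vanishes at ±1; the last holds because w does.

The two equations become accessible because the weight coefficients collapse to products of
binomials (`weightCoeff_eq`): C(N,n) C(N,m) Z_{n,m} is `bez N (n + 1) (m + 1)`. With x = (s+1/s)/2,
f(z) = (1+sz)^{N+1} and g(z) = (1+z/s)^{N+1}, these are the coefficients of the Bezoutian (f(z)g(y)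
- g(z)f(y)) / ((s-1/s)(z-y)). In this scaling a row of A₁Z is a three-term combination of
neighbouring Bezoutian rows, and it sums to the closed form `bezRow` (`bez_row`). That form is
antisymmetric in its two indices (`bezRow_antisymm`), and a telescoping sum of Chebyshev polynomials
of the first kind gives its derivative (`bezRow_derivative`).

The eigenvalue equation follows from symmetry. Since E does not raise degrees, R_nE - ΓR_n has
degree below n when Γ matches the leading coefficients, so it is orthogonal to R_n, and by symmetry
also to itself. Definiteness of the pairing then forces it to vanish. Definiteness comes from
`weight_posDef`: for |s| = 1 the Bezoutian factors as BB^*, the columns of B being the coefficient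
vectors of (1+sz)^j(1+z/s)^{N-j}, which form a basis when s ≠ 1/s. -/

/-- If `h` is antisymmetric under `t ↦ r - t`, then its partial sums of lengths `a` and `b` with
`a + b = r + 1` agree. -/
theorem sum_range_eq_of_antisymm {h : ℕ → ℝ[X]} {a b r : ℕ} (hr : a + b = r + 1)
    (hh : ∀ s t, s + t = r → h s = -h t) :
    ∑ t ∈ Finset.range a, h t = ∑ t ∈ Finset.range b, h t := by
  have key : ∑ t ∈ Finset.range (r + 1), h t = 0 := by
    have h1 : ∑ t ∈ Finset.range (r + 1), h (r + 1 - 1 - t) = ∑ t ∈ Finset.range (r + 1), h t :=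
      Finset.sum_range_reflect h (r + 1)
    have h2 : ∑ t ∈ Finset.range (r + 1), h (r + 1 - 1 - t)
        = -∑ t ∈ Finset.range (r + 1), h t := by
      rw [← Finset.sum_neg_distrib]
      refine Finset.sum_congr rfl fun t ht => hh _ _ ?_
      have := Finset.mem_range.1 ht
      omega
    exact self_eq_neg.1 (h1.symm.trans h2)
  rw [← hr, Finset.sum_range_add, add_eq_zero_iff_eq_neg] at key
  rw [key, ← Finset.sum_range_reflect, ← Finset.sum_neg_distrib]
  refine Finset.sum_congr rfl fun t ht => ?_
  have := Finset.mem_range.1 ht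
  rw [hh (a + (b - 1 - t)) t (by omega), neg_neg]

/-- The sums `∑_{t<b} C(N+1,t) C(N+1,a+b-1-t) U_{a+b-2-2t}`, the entries of a Bezoutian. -/
def bez (N a b : ℕ) : ℝ[X] :=
  ∑ t ∈ Finset.range b, ((N + 1).choose t : ℝ[X]) * ((N + 1).choose (a + b - 1 - t) : ℝ[X])
    * Chebyshev.U ℝ ((a : ℤ) + b - 2 - 2 * t)

/-- The summand changes sign under t ↦ a+b-1-t, because U_{-k-2} = -U_k, so the summations to a and
to b agree. -/
theorem bez_comm (N a b : ℕ) : bez N a b = bez N b a := by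
  rcases Nat.eq_zero_or_pos (a + b) with h | h
  · obtain ⟨rfl, rfl⟩ : a = 0 ∧ b = 0 := by omega
    rfl
  · have := sum_range_eq_of_antisymm (a := b) (b := a) (r := a + b - 1)
      (h := fun t => ((N + 1).choose t : ℝ[X]) * ((N + 1).choose (a + b - 1 - t) : ℝ[X])
        * Chebyshev.U ℝ ((a : ℤ) + b - 2 - 2 * t)) (by omega) (by
        intro s t hst
        have h1 : a + b - 1 - s = t := by omega
        have h2 : a + b - 1 - t = s := by omega
        have h3 : (a : ℤ) + b - 2 - 2 * s = -((a : ℤ) + b - 2 - 2 * t) - 2 := by omega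
        simp only [h1, h2, h3, Chebyshev.U_neg_sub_two]
        ring)
    rw [bez, this, bez]
    refine Finset.sum_congr rfl fun t _ => ?_
    rw [add_comm a b, add_comm (a : ℤ) b]

@[simp] theorem bez_zero_right (N a : ℕ) : bez N a 0 = 0 := by simp [bez]

@[simp] theorem bez_zero_left (N b : ℕ) : bez N 0 b = 0 := by rw [bez_comm]; simp

/-- With `bez_zero_left`, this lets the three-term row relation hold in the first and last rows
without correction terms. -/
theorem bez_eq_zero (N a b : ℕ) (h : N + 1 < a) : bez N a b = 0 := by
  refine Finset.sum_eq_zero fun t ht => ?_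
  have := Finset.mem_range.1 ht
  rw [Nat.choose_eq_zero_of_lt (show N + 1 < a + b - 1 - t by omega)]
  simp

theorem choose_succ_cast (n k : ℕ) :
    ((k : ℝ[X]) + 1) * ((n + 1).choose (k + 1) : ℝ[X]) = ((n : ℝ[X]) + 1) * (n.choose k : ℝ[X]) := by
  have := Nat.add_one_mul_choose_eq n k
  have h : (((n + 1) * n.choose k : ℕ) : ℝ[X]) = ((n + 1).choose (k + 1) * (k + 1) : ℕ) := by
    rw [this]
  push_cast at h
  linear_combination -h

theorem choose_pascal_cast (n k : ℕ) :
    ((n + 1).choose (k + 1) : ℝ[X]) = (n.choose k : ℝ[X]) + (n.choose (k + 1) : ℝ[X]) := by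
  rw [Nat.choose_succ_succ]; push_cast; ring

/-- The absorption identity k C(N+2,k) = (N+2) C(N+1,k-1), with C(N+1,k-1) expressed through
Pascal's rule so that k = 0 needs no separate treatment. -/
theorem mul_choose_cast (N k : ℕ) :
    (k : ℝ[X]) * ((N + 2).choose k : ℝ[X])
      = ((N : ℝ[X]) + 2) * (((N + 2).choose k : ℝ[X]) - ((N + 1).choose k : ℝ[X])) := by
  cases k with
  | zero => simp
  | succ k =>
    have h1 := choose_succ_cast (N + 1) k
    have h2 := choose_pascal_cast (N + 1) k
    push_cast at h1 ⊢
    linear_combination h1 - ((N : ℝ[X]) + 2) * h2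

/-- Truncated form of the row relation of the Bezoutian. -/
theorem bez_row_truncated (N c : ℕ) (α : ℝ[X]) (M : ℕ) (hM : M + 1 ≤ c) :
    2 * α * ∑ t ∈ Finset.range M, ((N + 1).choose t : ℝ[X]) * ((N + 1).choose (c - t) : ℝ[X])
        * Chebyshev.U ℝ ((c : ℤ) - 1 - 2 * t)
      - 2 * ((N : ℝ[X]) + 2 - 2 * α) * X * ∑ t ∈ Finset.range M,
        ((N + 1).choose t : ℝ[X]) * ((N + 1).choose (c - 1 - t) : ℝ[X])
        * Chebyshev.U ℝ ((c : ℤ) - 2 - 2 * t)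
      - 2 * ((N : ℝ[X]) + 2 - α) * ∑ t ∈ Finset.range M,
        ((N + 1).choose t : ℝ[X]) * ((N + 1).choose (c - 2 - t) : ℝ[X])
        * Chebyshev.U ℝ ((c : ℤ) - 3 - 2 * t)
    = (2 * α - (c : ℝ[X])) * ∑ t ∈ Finset.range M,
        ((N + 2).choose t : ℝ[X]) * ((N + 2).choose (c - t) : ℝ[X])
        * Chebyshev.U ℝ ((c : ℤ) - 1 - 2 * t)
      - (((N : ℝ[X]) + 2 - 2 * α) * ((N + 1).choose (c - M) : ℝ[X])
          + 2 * ((N : ℝ[X]) + 2 - α) * ((N + 1).choose (c - 1 - M) : ℝ[X]))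
        * (((N + 2).choose M : ℝ[X]) - ((N + 1).choose M : ℝ[X]))
        * Chebyshev.U ℝ ((c : ℤ) - 1 - 2 * M) := by
  induction M with
  | zero => simp
  | succ M ih =>
    obtain ⟨k, rfl⟩ : ∃ k, c = M + 2 + k := ⟨c - M - 2, by omega⟩
    specialize ih (by omega)
    simp only [Finset.sum_range_succ]
    rw [show M + 2 + k - M = k + 2 by omega, show M + 2 + k - 1 - M = k + 1 by omega] at ih ⊢
    rw [show M + 2 + k - 2 - M = k by omega, show M + 2 + k - (M + 1) = k + 1 by omega,
      show M + 2 + k - 1 - (M + 1) = k by omega]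
    -- The three-term recurrence removes the lowest of the three consecutive polynomials. The
    -- coefficients of the other two then match by absorption and Pascal's rule, and the boundary
    -- term carries the remainder to the next step.
    have e1 := Chebyshev.U_sub_one ℝ (((M + 2 + k : ℕ) : ℤ) - 2 - 2 * (M : ℤ))
    rw [show ((M + 2 + k : ℕ) : ℤ) - 2 - 2 * (M : ℤ) - 1 = ((M + 2 + k : ℕ) : ℤ) - 3 - 2 * (M : ℤ)
        by ring, show ((M + 2 + k : ℕ) : ℤ) - 2 - 2 * (M : ℤ) + 1
          = ((M + 2 + k : ℕ) : ℤ) - 1 - 2 * (M : ℤ) by ring] at e1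
    rw [show ((M + 2 + k : ℕ) : ℤ) - 1 - 2 * ((M + 1 : ℕ) : ℤ)
      = ((M + 2 + k : ℕ) : ℤ) - 3 - 2 * (M : ℤ) by push_cast; ring]
    have h1 := mul_choose_cast N M
    have h2 := mul_choose_cast N (k + 2)
    have p2 : ((N + 2).choose (k + 2) : ℝ[X]) = _ := choose_pascal_cast (N + 1) (k + 1)
    have p3 : ((N + 2).choose (M + 1) : ℝ[X]) = _ := choose_pascal_cast (N + 1) M
    generalize Chebyshev.U ℝ (((M + 2 + k : ℕ) : ℤ) - 1 - 2 * (M : ℤ)) = u1 at *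
    generalize Chebyshev.U ℝ (((M + 2 + k : ℕ) : ℤ) - 2 - 2 * (M : ℤ)) = u2 at *
    generalize Chebyshev.U ℝ (((M + 2 + k : ℕ) : ℤ) - 3 - 2 * (M : ℤ)) = u3 at *
    rw [p2] at h2 ⊢
    rw [p3, e1]
    push_cast at h1 h2 ih ⊢
    linear_combination ih + u1 * ((((N + 1).choose (k + 1) : ℝ[X]) + ((N + 1).choose (k + 2) : ℝ[X])) * h1
      + ((N + 2).choose M : ℝ[X]) * h2)

/-- The rows of the first order operator applied to the Bezoutian, in closed form. -/
def bezRow (N a b : ℕ) : ℝ[X] :=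
  ((a : ℝ[X]) - (b : ℝ[X])) * ∑ t ∈ Finset.range b,
      ((N + 2).choose t : ℝ[X]) * ((N + 2).choose (a + b - t) : ℝ[X])
      * Chebyshev.U ℝ ((a : ℤ) + b - 1 - 2 * t)
    - ((N : ℝ[X]) + 2) * ((N + 1).choose (b - 1) : ℝ[X]) * ((N + 1).choose a : ℝ[X])
      * Chebyshev.U ℝ ((a : ℤ) - b - 1)

theorem bez_row (N a b : ℕ) :
    2 * ((a : ℝ[X]) + 1) * bez N (a + 2) (b + 1)
      - 2 * ((N : ℝ[X]) - 2 * (a : ℝ[X])) * X * bez N (a + 1) (b + 1)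
      - 2 * ((N : ℝ[X]) + 1 - (a : ℝ[X])) * bez N a (b + 1) = bezRow N (a + 1) (b + 1) := by
  -- With α equal to the row index, 2α - c becomes the difference of the two indices, and absorption
  -- at a+1 reduces the boundary coefficient to (N+2) C(N+1,b) C(N+1,a+1).
  have h := bez_row_truncated N (a + 1 + (b + 1)) (a + 1) (b + 1) (by omega)
  have e1 : bez N (a + 2) (b + 1) = ∑ t ∈ Finset.range (b + 1),
      ((N + 1).choose t : ℝ[X]) * ((N + 1).choose (a + 1 + (b + 1) - t) : ℝ[X])
        * Chebyshev.U ℝ (((a + 1 + (b + 1) : ℕ) : ℤ) - 1 - 2 * t) := by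
    refine Finset.sum_congr rfl fun t _ => ?_
    rw [show a + 2 + (b + 1) - 1 - t = a + 1 + (b + 1) - t by omega]
    congr 2; push_cast; ring
  have e2 : bez N (a + 1) (b + 1) = ∑ t ∈ Finset.range (b + 1),
      ((N + 1).choose t : ℝ[X]) * ((N + 1).choose (a + 1 + (b + 1) - 1 - t) : ℝ[X])
        * Chebyshev.U ℝ (((a + 1 + (b + 1) : ℕ) : ℤ) - 2 - 2 * t) := by
    refine Finset.sum_congr rfl fun t _ => ?_
    simp only [Nat.cast_add (a + 1) (b + 1)]
  have e3 : bez N a (b + 1) = ∑ t ∈ Finset.range (b + 1),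
      ((N + 1).choose t : ℝ[X]) * ((N + 1).choose (a + 1 + (b + 1) - 2 - t) : ℝ[X])
        * Chebyshev.U ℝ (((a + 1 + (b + 1) : ℕ) : ℤ) - 3 - 2 * t) := by
    refine Finset.sum_congr rfl fun t _ => ?_
    rw [show a + (b + 1) - 1 - t = a + 1 + (b + 1) - 2 - t by omega]
    congr 2; push_cast; ring
  rw [e1, e2, e3, bezRow]
  rw [show a + 1 + (b + 1) - (b + 1) = a + 1 by omega,
    show a + 1 + (b + 1) - 1 - (b + 1) = a by omega,
    show ((a + 1 + (b + 1) : ℕ) : ℤ) - 1 - 2 * ((b + 1 : ℕ) : ℤ)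
      = ((a + 1 : ℕ) : ℤ) - ((b + 1 : ℕ) : ℤ) - 1 by push_cast; ring] at h
  simp only [Nat.cast_add (a + 1) (b + 1), Nat.add_sub_cancel] at h ⊢
  have p : ((N + 2).choose (b + 1) : ℝ[X]) = _ := choose_pascal_cast (N + 1) b
  have q := mul_choose_cast N (a + 1)
  have p' : ((N + 2).choose (a + 1) : ℝ[X]) = _ := choose_pascal_cast (N + 1) a
  rw [p'] at q
  rw [p] at h
  push_cast at h q ⊢
  linear_combination h + 2 * ((N + 1).choose b : ℝ[X])
      * Chebyshev.U ℝ ((a : ℤ) + 1 - (b + 1) - 1) * q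

theorem bezRow_antisymm (N a b : ℕ) :
    bezRow N (a + 1) (b + 1) = -bezRow N (b + 1) (a + 1) := by
  -- The reflection t ↦ a+b+2-t matches length b+1 with length a+2, one more than the sum in the
  -- transposed entry. The surplus term is absorbed by the two boundary terms.
  have h := sum_range_eq_of_antisymm (a := b + 1) (b := a + 1 + 1) (r := a + 1 + (b + 1))
      (h := fun t => ((N + 2).choose t : ℝ[X]) * ((N + 2).choose (a + 1 + (b + 1) - t) : ℝ[X])
        * Chebyshev.U ℝ (((a + 1 : ℕ) : ℤ) + ((b + 1 : ℕ) : ℤ) - 1 - 2 * t)) (by omega) (by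
        intro s t hst
        have h1 : a + 1 + (b + 1) - s = t := by omega
        have h2 : a + 1 + (b + 1) - t = s := by omega
        have h3 : ((a + 1 : ℕ) : ℤ) + ((b + 1 : ℕ) : ℤ) - 1 - 2 * s
          = -(((a + 1 : ℕ) : ℤ) + ((b + 1 : ℕ) : ℤ) - 1 - 2 * t) - 2 := by omega
        simp only [h1, h2, h3, Chebyshev.U_neg_sub_two]
        ring)
  rw [bezRow, h, Finset.sum_range_succ, bezRow, add_comm (b + 1) (a + 1),
    add_comm ((b + 1 : ℕ) : ℤ) ((a + 1 : ℕ) : ℤ), show a + 1 + (b + 1) - (a + 1) = b + 1 by omega,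
    show ((a + 1 : ℕ) : ℤ) + ((b + 1 : ℕ) : ℤ) - 1 - 2 * ((a + 1 : ℕ) : ℤ)
      = ((b + 1 : ℕ) : ℤ) - ((a + 1 : ℕ) : ℤ) - 1 by ring,
    show ((a + 1 : ℕ) : ℤ) - ((b + 1 : ℕ) : ℤ) - 1
      = -(((b + 1 : ℕ) : ℤ) - ((a + 1 : ℕ) : ℤ) - 1) - 2 by ring, Chebyshev.U_neg_sub_two]
  generalize Chebyshev.U ℝ (((b + 1 : ℕ) : ℤ) - ((a + 1 : ℕ) : ℤ) - 1) = u
  simp only [Nat.add_sub_cancel]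
  have p : ((N + 2).choose (b + 1) : ℝ[X]) = _ := choose_pascal_cast (N + 1) b
  have q := mul_choose_cast N (a + 1)
  have p' : ((N + 2).choose (a + 1) : ℝ[X]) = _ := choose_pascal_cast (N + 1) a
  have q' := mul_choose_cast N (b + 1)
  rw [p'] at q
  rw [p] at q'
  rw [p, p']
  push_cast at q q' ⊢
  linear_combination u * (((N + 1).choose b : ℝ[X]) + ((N + 1).choose (b + 1) : ℝ[X])) * q
    - u * (((N + 1).choose a : ℝ[X]) + ((N + 1).choose (a + 1) : ℝ[X])) * q'

/-! ### The differential equation for the rows -/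

theorem X_mul_U_sub_derivative (k : ℤ) :
    X * Chebyshev.U ℝ (k - 1) - (1 - X ^ 2) * derivative (Chebyshev.U ℝ (k - 1))
      = (k : ℝ[X]) * Chebyshev.T ℝ k := by
  have := Chebyshev.add_one_mul_T_eq_poly_in_U (R := ℝ) (k - 1)
  rw [sub_add_cancel] at this
  rw [← this]; push_cast; ring

theorem two_mul_one_sub_X_sq_mul_U (k : ℤ) :
    2 * ((1 - X ^ 2) * Chebyshev.U ℝ (k - 1)) = Chebyshev.T ℝ (k - 1) - Chebyshev.T ℝ (k + 1) := by
  have := Chebyshev.one_sub_X_sq_mul_U_eq_pol_in_T ℝ (k - 1)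
  rw [show k - 1 + 2 = k + 1 by ring, show k - 1 + 1 = k by ring] at this
  rw [this, Chebyshev.T_add_one]
  ring

/-- Truncated form of the differential equation for the rows. -/
theorem bezRow_derivative_truncated (N c M : ℕ) (hM : M ≤ c) :
    ∑ t ∈ Finset.range M, ((N + 2).choose t : ℝ[X]) * ((N + 2).choose (c - t) : ℝ[X])
        * ((c : ℝ[X]) - 2 * (t : ℝ[X])) * Chebyshev.T ℝ ((c : ℤ) - 2 * t)
      + ((N : ℝ[X]) + 2) * ∑ t ∈ Finset.range M, ((N + 1).choose t : ℝ[X])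
        * ((N + 1).choose (c - 1 - t) : ℝ[X])
        * (Chebyshev.T ℝ ((c : ℤ) - 2 - 2 * t) - Chebyshev.T ℝ ((c : ℤ) - 2 * t))
    = ((N : ℝ[X]) + 2) * (((N + 2).choose M : ℝ[X]) - ((N + 1).choose M : ℝ[X]))
        * ((N + 1).choose (c - M) : ℝ[X]) * Chebyshev.T ℝ ((c : ℤ) - 2 * M) := by
  induction M with
  | zero => simp
  | succ M ih =>
    obtain ⟨k, rfl⟩ : ∃ k, c = M + 1 + k := ⟨c - M - 1, by omega⟩
    specialize ih (by omega)
    simp only [Finset.sum_range_succ]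
    rw [show M + 1 + k - M = k + 1 by omega] at ih ⊢
    rw [show M + 1 + k - 1 - M = k by omega, show M + 1 + k - (M + 1) = k by omega,
      show ((M + 1 + k : ℕ) : ℤ) - 2 * ((M + 1 : ℕ) : ℤ)
        = ((M + 1 + k : ℕ) : ℤ) - 2 - 2 * (M : ℤ) by push_cast; ring]
    have h1 := mul_choose_cast N M
    have h2 := mul_choose_cast N (k + 1)
    have p2 : ((N + 2).choose (k + 1) : ℝ[X]) = _ := choose_pascal_cast (N + 1) k
    have p3 : ((N + 2).choose (M + 1) : ℝ[X]) = _ := choose_pascal_cast (N + 1) M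
    generalize Chebyshev.T ℝ (((M + 1 + k : ℕ) : ℤ) - 2 * (M : ℤ)) = u1 at *
    generalize Chebyshev.T ℝ (((M + 1 + k : ℕ) : ℤ) - 2 - 2 * (M : ℤ)) = u2 at *
    rw [p2] at h2 ⊢
    rw [p3]
    push_cast at h1 h2 ih ⊢
    linear_combination ih + u1 * (((N + 2).choose M : ℝ[X]) * h2
      - (((N + 1).choose k : ℝ[X]) + ((N + 1).choose (k + 1) : ℝ[X])) * h1)

/-- Since w' = -x/w, this is the polynomial form of (w · `bezRow`)' = 2(N+2)(a-b) w · `bez`. Both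
Chebyshev identities above turn it into a statement about the T_k, where the coefficient (c-2t)
C(N+2,t) C(N+2,c-t) is N+2 times a difference of consecutive products C(N+1,t) C(N+1,c-1-t), so the
sums telescope. -/
theorem bezRow_derivative (N a b : ℕ) :
    X * bezRow N (a + 1) (b + 1) - (1 - X ^ 2) * derivative (bezRow N (a + 1) (b + 1))
      + 2 * ((N : ℝ[X]) + 2) * ((a : ℝ[X]) - (b : ℝ[X])) * ((1 - X ^ 2) * bez N (a + 1) (b + 1)) = 0 := by
  have h := bezRow_derivative_truncated N (a + 1 + (b + 1)) (b + 1) (by omega)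
  have hL : ∀ k : ℤ, (1 - X ^ 2) * derivative (Chebyshev.U ℝ (k - 1))
      = X * Chebyshev.U ℝ (k - 1) - (k : ℝ[X]) * Chebyshev.T ℝ k := fun k => by
    rw [← X_mul_U_sub_derivative]; ring
  have e1 : X * ∑ t ∈ Finset.range (b + 1),
      ((N + 2).choose t : ℝ[X]) * ((N + 2).choose (a + 1 + (b + 1) - t) : ℝ[X])
        * Chebyshev.U ℝ (((a + 1 : ℕ) : ℤ) + ((b + 1 : ℕ) : ℤ) - 1 - 2 * t)
      - (1 - X ^ 2) * derivative (∑ t ∈ Finset.range (b + 1),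
      ((N + 2).choose t : ℝ[X]) * ((N + 2).choose (a + 1 + (b + 1) - t) : ℝ[X])
        * Chebyshev.U ℝ (((a + 1 : ℕ) : ℤ) + ((b + 1 : ℕ) : ℤ) - 1 - 2 * t))
      = ∑ t ∈ Finset.range (b + 1),
        ((N + 2).choose t : ℝ[X]) * ((N + 2).choose (a + 1 + (b + 1) - t) : ℝ[X])
        * (((a + 1 + (b + 1) : ℕ) : ℝ[X]) - 2 * (t : ℝ[X]))
        * Chebyshev.T ℝ (((a + 1 + (b + 1) : ℕ) : ℤ) - 2 * t) := by
    rw [derivative_sum, Finset.mul_sum, Finset.mul_sum, ← Finset.sum_sub_distrib]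
    refine Finset.sum_congr rfl fun t _ => ?_
    have := hL (((a + 1 + (b + 1) : ℕ) : ℤ) - 2 * t)
    rw [show ((a + 1 + (b + 1) : ℕ) : ℤ) - 2 * (t : ℤ) - 1
      = ((a + 1 : ℕ) : ℤ) + ((b + 1 : ℕ) : ℤ) - 1 - 2 * t by push_cast; ring] at this
    simp only [derivative_mul, derivative_natCast]
    push_cast at this ⊢
    linear_combination -((N + 2).choose t : ℝ[X]) * ((N + 2).choose (a + 1 + (b + 1) - t) : ℝ[X])
      * this
  have e2 : 2 * ((1 - X ^ 2) * bez N (a + 1) (b + 1)) = ∑ t ∈ Finset.range (b + 1),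
      ((N + 1).choose t : ℝ[X]) * ((N + 1).choose (a + 1 + (b + 1) - 1 - t) : ℝ[X])
        * (Chebyshev.T ℝ (((a + 1 + (b + 1) : ℕ) : ℤ) - 2 - 2 * t)
          - Chebyshev.T ℝ (((a + 1 + (b + 1) : ℕ) : ℤ) - 2 * t)) := by
    rw [bez, Finset.mul_sum, Finset.mul_sum]
    refine Finset.sum_congr rfl fun t _ => ?_
    have := two_mul_one_sub_X_sq_mul_U (((a + 1 + (b + 1) : ℕ) : ℤ) - 1 - 2 * t)
    rw [show ((a + 1 + (b + 1) : ℕ) : ℤ) - 1 - 2 * (t : ℤ) - 1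
      = ((a + 1 + (b + 1) : ℕ) : ℤ) - 2 - 2 * t by ring,
      show ((a + 1 + (b + 1) : ℕ) : ℤ) - 1 - 2 * (t : ℤ) + 1
      = ((a + 1 + (b + 1) : ℕ) : ℤ) - 2 * t by ring] at this
    rw [← this, ← Nat.cast_add (a + 1) (b + 1)]
    ring
  have e3 := hL (((a + 1 : ℕ) : ℤ) - ((b + 1 : ℕ) : ℤ))
  have p : ((N + 2).choose (b + 1) : ℝ[X]) = _ := choose_pascal_cast (N + 1) b
  rw [← e1, ← e2, p, show a + 1 + (b + 1) - (b + 1) = a + 1 by omega,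
    show ((a + 1 + (b + 1) : ℕ) : ℤ) - 2 * ((b + 1 : ℕ) : ℤ)
      = ((a + 1 : ℕ) : ℤ) - ((b + 1 : ℕ) : ℤ) by push_cast; ring] at h
  rw [bezRow]
  simp only [derivative_sub, derivative_mul, derivative_natCast, derivative_add,
    Nat.add_sub_cancel, derivative_ofNat]
  generalize ∑ t ∈ Finset.range (b + 1),
      ((N + 2).choose t : ℝ[X]) * ((N + 2).choose (a + 1 + (b + 1) - t) : ℝ[X])
        * Chebyshev.U ℝ (((a + 1 : ℕ) : ℤ) + ((b + 1 : ℕ) : ℤ) - 1 - 2 * t) = S at *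
  generalize Chebyshev.U ℝ (((a + 1 : ℕ) : ℤ) - ((b + 1 : ℕ) : ℤ) - 1) = u at *
  generalize Chebyshev.T ℝ (((a + 1 : ℕ) : ℤ) - ((b + 1 : ℕ) : ℤ)) = v at *
  push_cast at h e3 ⊢
  linear_combination ((a : ℝ[X]) - (b : ℝ[X])) * h
    + ((N : ℝ[X]) + 2) * ((N + 1).choose b : ℝ[X]) * ((N + 1).choose (a + 1) : ℝ[X]) * e3

/-! ### The weight as a rescaled Bezoutian -/

theorem eval_ascPochhammer_neg_sub (N n k : ℕ) (hn : n ≤ N) :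
    (-1) ^ k * (ascPochhammer ℝ k).eval ((n : ℝ) - N) = ((N - n).descFactorial k : ℝ) := by
  have h : ((n : ℝ) - N) = -((N - n : ℕ) : ℝ) := by push_cast [hn]; ring
  rw [h, ascPochhammer_eval_neg_eq_descPochhammer, ← mul_assoc, ← mul_pow,
    descPochhammer_eval_eq_descFactorial]
  norm_num

theorem eval_ascPochhammer_nat (n k : ℕ) :
    (ascPochhammer ℝ k).eval ((n : ℝ) + 1) * (n.factorial : ℝ) = ((n + k).factorial : ℝ) := by
  have := Nat.factorial_mul_ascFactorial n k
  rw [← this, ← Nat.cast_succ, ascPochhammer_nat_eq_natCast_ascFactorial]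
  push_cast; ring

/-- Every Pochhammer symbol is a ratio of factorials. The signed one is a falling factorial of N-n,
which vanishes for m-t > N-n, exactly where the second binomial does. -/
theorem weightCoeff_eq (N n m t : ℕ) (hn : n ≤ N) (hm : m ≤ N) (ht : t ≤ m) :
    weightCoeff N n m t = ((N + 1).choose t : ℝ) * ((N + 1).choose (n + m + 1 - t) : ℝ)
      / ((N.choose n : ℝ) * (N.choose m : ℝ)) := by
  obtain ⟨k, rfl⟩ := Nat.exists_eq_add_of_le ht
  have e1 := eval_ascPochhammer_neg_sub N n k hn
  have e2 := eval_ascPochhammer_nat (n + 1) k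
  have e3 := eval_ascPochhammer_nat (N + 1 - t) t
  have e4 : ((N + 1).choose t : ℝ) * t.factorial * (N + 1 - t).factorial = (N + 1).factorial := by
    exact_mod_cast Nat.choose_mul_factorial_mul_factorial (show t ≤ N + 1 by omega)
  have e5 : (N.choose n : ℝ) * n.factorial * (N - n).factorial = N.factorial := by
    exact_mod_cast Nat.choose_mul_factorial_mul_factorial hn
  have e6 : (N.choose (t + k) : ℝ) * (t + k).factorial * (N - (t + k)).factorial = N.factorial := by
    exact_mod_cast Nat.choose_mul_factorial_mul_factorial hm
  -- The falling factorial of N+1 of length n+1+k splits as the one of length n+1 times that of N-n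
  -- of length k.
  have e7 : ((N + 1).choose (n + 1 + k) : ℝ) * (n + 1 + k).factorial * (N - n).factorial
      = (N + 1).factorial * ((N - n).descFactorial k) := by
    have h1 : (N + 1).descFactorial (n + 1 + k)
        = (N + 1 - (n + 1)).descFactorial k * (N + 1).descFactorial (n + 1) := by
      have := Nat.descFactorial_mul_descFactorial (n := N + 1) (show n + 1 ≤ n + 1 + k by omega)
      rwa [Nat.add_sub_cancel_left, eq_comm] at this
    have h2 := Nat.descFactorial_eq_factorial_mul_choose (N + 1) (n + 1 + k)
    have h3 := Nat.factorial_mul_descFactorial (show n + 1 ≤ N + 1 by omega)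
    rw [show N + 1 - (n + 1) = N - n by omega] at h1 h3
    rw [← h3]
    have : (N + 1).choose (n + 1 + k) * (n + 1 + k).factorial
        = (N - n).descFactorial k * (N + 1).descFactorial (n + 1) := by
      rw [← h1, h2]; ring
    have h' : ((N + 1).choose (n + 1 + k) : ℝ) * (n + 1 + k).factorial
        = (N - n).descFactorial k * (N + 1).descFactorial (n + 1) := by exact_mod_cast this
    rw [h']; push_cast; ring
  have c1 : (((N + 1 - t : ℕ) : ℝ) + 1) = (N : ℝ) + 2 - t := by
    push_cast [show t ≤ N + 1 by omega]; ring
  rw [c1, show N + 1 - t + t = N + 1 by omega] at e3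
  have c2 : (((n + 1 : ℕ) : ℝ) + 1) = (n : ℝ) + 2 := by push_cast; ring
  rw [c2] at e2
  unfold weightCoeff
  rw [show n + (t + k) + 1 - t = n + 1 + k by omega, show t + k - t = k by omega]
  have p2 : (ascPochhammer ℝ k).eval ((n : ℝ) + 2) ≠ 0 := by
    intro h0; rw [h0, zero_mul] at e2
    exact (Nat.cast_ne_zero.2 (Nat.factorial_ne_zero _)) e2.symm
  have f0 : ∀ j : ℕ, (j.factorial : ℝ) ≠ 0 := fun j => Nat.cast_ne_zero.2 (Nat.factorial_ne_zero _)
  have q1 : (N.choose n : ℝ) ≠ 0 := Nat.cast_ne_zero.2 (Nat.choose_pos hn).ne'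
  have q2 : (N.choose (t + k) : ℝ) ≠ 0 := Nat.cast_ne_zero.2 (Nat.choose_pos hm).ne'
  rw [Nat.factorial_succ N] at e4 e3 e7
  rw [Nat.factorial_succ n] at e2
  push_cast at e2 e3 e4 e7 ⊢
  have r1 : (ascPochhammer ℝ k).eval ((n : ℝ) + 2)
      = (n + 1 + k).factorial / (((n : ℝ) + 1) * n.factorial) := by
    rw [eq_div_iff (by have := f0 n; positivity)]; exact e2
  have r2 : (ascPochhammer ℝ t).eval ((N : ℝ) + 2 - t)
      = ((N : ℝ) + 1) * N.factorial / (N + 1 - t).factorial := by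
    rw [eq_div_iff (f0 _)]; exact e3
  have r3 : ((N + 1).choose t : ℝ)
      = ((N : ℝ) + 1) * N.factorial / (t.factorial * (N + 1 - t).factorial) := by
    rw [eq_div_iff (mul_ne_zero (f0 _) (f0 _)), ← mul_assoc]; exact e4
  have r4 : (N.choose n : ℝ) = N.factorial / (n.factorial * (N - n).factorial) := by
    rw [eq_div_iff (mul_ne_zero (f0 _) (f0 _)), ← mul_assoc]; exact e5
  have r5 : (N.choose (t + k) : ℝ)
      = N.factorial / ((t + k).factorial * (N - (t + k)).factorial) := by
    rw [eq_div_iff (mul_ne_zero (f0 _) (f0 _)), ← mul_assoc]; exact e6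
  have r6 : ((N + 1).choose (n + 1 + k) : ℝ) = ((N : ℝ) + 1) * N.factorial
      * ((N - n).descFactorial k) / ((n + 1 + k).factorial * (N - n).factorial) := by
    rw [eq_div_iff (mul_ne_zero (f0 _) (f0 _)), ← mul_assoc]; exact e7
  rw [← mul_div_assoc ((-1 : ℝ) ^ k), e1, r1, r2, r3, r4, r5, r6]
  have := f0 n; have := f0 N; have := f0 t; have := f0 (N - n); have := f0 (t + k)
  have := f0 (N - (t + k)); have := f0 (n + 1 + k); have := f0 (N + 1 - t)
  have : (n : ℝ) + 1 ≠ 0 := by positivity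
  have : (N : ℝ) + 1 ≠ 0 := by positivity
  field_simp

/-- The entries of `Z(x)` as polynomials. -/
def zPoly (N n m : ℕ) : ℝ[X] :=
  C (((N.choose n : ℝ) * (N.choose m : ℝ))⁻¹) * bez N (n + 1) (m + 1)

theorem zPoly_comm (N n m : ℕ) : zPoly N n m = zPoly N m n := by
  rw [zPoly, zPoly, bez_comm, mul_comm (N.choose n : ℝ)]

theorem weightEntry_eq (N n m : ℕ) (hn : n ≤ N) (hm : m ≤ N) (x : ℝ) :
    weightEntry N n m x = (zPoly N n m).eval x := by
  rw [weightEntry, zPoly, bez, eval_C_mul, eval_finsetSum, Finset.mul_sum]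
  refine Finset.sum_congr rfl fun t ht => ?_
  rw [weightCoeff_eq N n m t hn hm (Nat.lt_succ_iff.1 (Finset.mem_range.1 ht)),
    show n + 1 + (m + 1) - 1 - t = n + m + 1 - t by omega,
    show ((n + 1 : ℕ) : ℤ) + ((m + 1 : ℕ) : ℤ) - 2 - 2 * (t : ℤ) = (n : ℤ) + m - 2 * t by
      push_cast; ring]
  simp only [eval_mul, eval_natCast]
  ring

theorem matrixZ_apply (N : ℕ) (x : ℝ) (n m : Fin (N + 1)) :
    matrixZ N x n m = (zPoly N n m).eval x := by
  have hn : (n : ℕ) ≤ N := Nat.lt_succ_iff.1 n.2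
  have hm : (m : ℕ) ≤ N := Nat.lt_succ_iff.1 m.2
  simp only [matrixZ, Matrix.of_apply]
  split_ifs
  · exact weightEntry_eq N n m hn hm x
  · rw [zPoly_comm]; exact weightEntry_eq N m n hm hn x

/-- The scalar weight `(1-x)^{1/2} (1+x)^{1/2}`. -/
def scalarWeight (x : ℝ) : ℝ := Real.sqrt (1 - x) * Real.sqrt (1 + x)

theorem weight_apply (N : ℕ) (x : ℝ) (n m : Fin (N + 1)) :
    weight N x n m = ((scalarWeight x * (zPoly N n m).eval x : ℝ) : ℂ) := by
  simp [weight, scalarWeight, matrixZ_apply]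

theorem weight_conjTranspose (N : ℕ) (x : ℝ) : (weight N x).conjTranspose = weight N x := by
  ext n m
  rw [Matrix.conjTranspose_apply, weight_apply, weight_apply, zPoly_comm]
  exact Complex.conj_ofReal _

theorem continuous_scalarWeight : Continuous scalarWeight := by
  unfold scalarWeight; fun_prop

theorem continuous_weight (N : ℕ) (n m : Fin (N + 1)) : Continuous fun x => weight N x n m := by
  simp only [weight_apply]
  have := continuous_scalarWeight
  fun_prop

theorem hasDerivAt_scalarWeight {x : ℝ} (hx : x ∈ Set.Ioo (-1 : ℝ) 1) :
    HasDerivAt scalarWeight (-x / scalarWeight x) x := by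
  have h1 : 0 < 1 - x := by linarith [hx.2]
  have h2 : 0 < 1 + x := by linarith [hx.1]
  have d1 : HasDerivAt (fun y : ℝ => Real.sqrt (1 - y)) _ x :=
    ((hasDerivAt_id x).const_sub 1).sqrt h1.ne'
  have d2 : HasDerivAt (fun y : ℝ => Real.sqrt (1 + y)) _ x :=
    ((hasDerivAt_id x).const_add 1).sqrt h2.ne'
  refine (d1.mul d2).congr_deriv ?_
  have p1 := Real.sqrt_pos.2 h1
  have p2 := Real.sqrt_pos.2 h2
  have s1 := Real.sq_sqrt h1.le
  have s2 := Real.sq_sqrt h2.le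
  simp only [scalarWeight, id]
  field_simp
  rw [s1, s2]; ring

/-! ### The first order operator on the weight -/

section Eval

variable {ι : Type} [Fintype ι] [DecidableEq ι]

theorem commute_algebraMap (M : Matrix ι ι ℂ) (z : ℂ) :
    Commute M (algebraMap ℂ (Matrix ι ι ℂ) z) := (Algebra.commutes z M).symm

@[simp] theorem evalAt_add (P Q : (Matrix ι ι ℂ)[X]) (x : ℝ) :
    evalAt (P + Q) x = evalAt P x + evalAt Q x := eval_add

@[simp] theorem evalAt_sub (P Q : (Matrix ι ι ℂ)[X]) (x : ℝ) :
    evalAt (P - Q) x = evalAt P x - evalAt Q x := eval_sub _ _ _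

@[simp] theorem evalAt_C (M : Matrix ι ι ℂ) (x : ℝ) : evalAt (C M) x = M := eval_C

-- Evaluation is multiplicative despite the noncommuting coefficients because the point is a scalar
-- matrix, hence central.
@[simp] theorem evalAt_mul (P Q : (Matrix ι ι ℂ)[X]) (x : ℝ) :
    evalAt (P * Q) x = evalAt P x * evalAt Q x :=
  eval₂_mul_noncomm _ _ fun _ => commute_algebraMap _ _

@[simp] theorem evalAt_X (x : ℝ) :
    evalAt (X : (Matrix ι ι ℂ)[X]) x = algebraMap ℂ (Matrix ι ι ℂ) (x : ℂ) := eval_X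

@[simp] theorem evalAt_sum {κ : Type*} (s : Finset κ) (P : κ → (Matrix ι ι ℂ)[X]) (x : ℝ) :
    evalAt (∑ k ∈ s, P k) x = ∑ k ∈ s, evalAt (P k) x := eval_finsetSum _ _ _

end Eval

theorem sum_smul_elem_apply (N : ℕ) (c : ℕ → ℂ) (δ : ℕ → ℤ) (a b : Fin (N + 1)) :
    (∑ i ∈ Finset.range (N + 1), c i • elem N i (δ i)) a b
      = if ((b : ℕ) : ℤ) = δ a then c a else 0 := by
  rw [Matrix.sum_apply, Finset.sum_eq_single_of_mem (a : ℕ) (Finset.mem_range.2 a.2)]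
  · simp [elem]
  · intro i _ hi
    simp [elem, hi.symm]

theorem evalAt_coeffA1_apply (N : ℕ) (x : ℝ) (a b : Fin (N + 1)) :
    evalAt (coeffA1 N) x a b
      = (if ((b : ℕ) : ℤ) = ((a : ℕ) : ℤ) + 1 then ((N : ℂ) - (a : ℕ)) / N else 0)
        - (if ((b : ℕ) : ℤ) = ((a : ℕ) : ℤ) then
            (x : ℂ) * (((N : ℂ) / 2 - (a : ℕ)) / ((N : ℂ) / 2)) else 0)
        - (if ((b : ℕ) : ℤ) = ((a : ℕ) : ℤ) - 1 then ((a : ℕ) : ℂ) / N else 0) := by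
  simp only [coeffA1, evalAt_sub, evalAt_sum, evalAt_C, evalAt_mul, evalAt_X]
  simp only [Algebra.algebraMap_eq_smul_one, smul_mul_assoc, one_mul, smul_smul]
  rw [Matrix.sub_apply, Matrix.sub_apply, sum_smul_elem_apply N (fun i => ((N : ℂ) - i) / N)
    (fun i => (i : ℤ) + 1), sum_smul_elem_apply N
    (fun i => (x : ℂ) * (((N : ℂ) / 2 - i) / ((N : ℂ) / 2))) (fun i => (i : ℤ)),
    sum_smul_elem_apply N (fun i => (i : ℂ) / N) (fun i => (i : ℤ) - 1)]

theorem coeffA0_eq (N : ℕ) : coeffA0 N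
    = Matrix.diagonal fun a : Fin (N + 1) => (((N : ℂ) + 2) * (((a : ℕ) : ℂ) - N)) / N := by
  ext a b
  rw [coeffA0, sum_smul_elem_apply N (fun i => (((N : ℂ) + 2) * ((i : ℂ) - N)) / N)
    (fun i => (i : ℤ)), Matrix.diagonal_apply]
  simp [Fin.ext_iff, eq_comm]

theorem coeffA1_mul_sum (N : ℕ) (x : ℝ) (a : Fin (N + 1)) (F : ℕ → ℂ) (hF : F (N + 1) = 0) :
    ∑ b : Fin (N + 1), evalAt (coeffA1 N) x a b * F b
      = ((N : ℂ) - (a : ℕ)) / N * F (a + 1)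
        - (x : ℂ) * (((N : ℂ) / 2 - (a : ℕ)) / ((N : ℂ) / 2)) * F a
        - ((a : ℕ) : ℂ) / N * F (a - 1) := by
  simp only [evalAt_coeffA1_apply, sub_mul, Finset.sum_sub_distrib, ite_mul, zero_mul]
  obtain ⟨a, ha⟩ := a
  have h := fun G : ℕ → ℂ => Fin.sum_univ_eq_sum_range G (N + 1)
  rw [h (fun b => if (b : ℤ) = (a : ℤ) + 1 then ((N : ℂ) - a) / N * F b else 0),
    h (fun b => if (b : ℤ) = (a : ℤ) then
      (x : ℂ) * (((N : ℂ) / 2 - a) / ((N : ℂ) / 2)) * F b else 0),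
    h (fun b => if (b : ℤ) = (a : ℤ) - 1 then (a : ℂ) / N * F b else 0)]
  congr 1
  · congr 1
    · have : ∀ b : ℕ, ((b : ℤ) = (a : ℤ) + 1) ↔ b = a + 1 := fun b => by omega
      simp only [this, Finset.sum_ite_eq', Finset.mem_range]
      split_ifs with h1
      · rfl
      · obtain rfl : a = N := by omega
        simp
    · simp only [Nat.cast_inj, Finset.sum_ite_eq', Finset.mem_range, ha, if_true]
  -- For a = 0 the truncated index `a - 1` is 0, but its coefficient a/N vanishes.
  · rcases a with _ | a
    · simp
    · have : ∀ b : ℕ, ((b : ℤ) = ((a + 1 : ℕ) : ℤ) - 1) ↔ b = a := fun b => by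
        push_cast; omega
      simp only [this, Finset.sum_ite_eq', Finset.mem_range, show a < N + 1 by omega, if_true,
        Nat.add_sub_cancel]

/-- The entries of `A₁(x) Z(x)` as polynomials. -/
def rowPoly (N n m : ℕ) : ℝ[X] :=
  C ((2 * (N : ℝ) * ((N.choose n : ℝ) * (N.choose m : ℝ)))⁻¹) * bezRow N (n + 1) (m + 1)

theorem coeffA1_mul_weight_apply (N : ℕ) (hN : 0 < N) (x : ℝ) (a b : Fin (N + 1)) :
    (evalAt (coeffA1 N) x * weight N x) a b
      = ((scalarWeight x * (rowPoly N a b).eval x : ℝ) : ℂ) := by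
  obtain ⟨a, ha⟩ := a
  obtain ⟨b, hb⟩ := b
  rw [Matrix.mul_apply]
  simp only [weight_apply]
  rw [coeffA1_mul_sum N x ⟨a, ha⟩
    (fun j => ((scalarWeight x * (zPoly N j b).eval x : ℝ) : ℂ)) (by
      simp [zPoly, bez_eq_zero])]
  have hN' : (N : ℝ) ≠ 0 := Nat.cast_ne_zero.2 hN.ne'
  have hrow := congrArg (eval x) (bez_row N a b)
  have key : ((N : ℝ) - a) / N * (scalarWeight x * (zPoly N (a + 1) b).eval x)
      - x * (((N : ℝ) / 2 - a) / ((N : ℝ) / 2)) * (scalarWeight x * (zPoly N a b).eval x)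
      - (a : ℝ) / N * (scalarWeight x * (zPoly N (a - 1) b).eval x)
      = scalarWeight x * (rowPoly N a b).eval x := by
    have q1 : (N.choose a : ℝ) ≠ 0 := Nat.cast_ne_zero.2 (Nat.choose_pos (by omega)).ne'
    have q2 : (N.choose b : ℝ) ≠ 0 := Nat.cast_ne_zero.2 (Nat.choose_pos (by omega)).ne'
    -- Dividing by C(N,a) turns the entries of A₁ into the coefficients of `bez_row`, via (a+1)
    -- C(N,a+1) = (N-a) C(N,a). For a = N both sides vanish.
    have s1 : ((N : ℝ) - a) * (zPoly N (a + 1) b).eval x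
        = ((a : ℝ) + 1) * ((N.choose a : ℝ) * (N.choose b : ℝ))⁻¹
          * (bez N (a + 2) (b + 1)).eval x := by
      rw [zPoly, eval_C_mul]
      rcases Nat.lt_or_ge a N with h | h
      · have q3 : (N.choose (a + 1) : ℝ) ≠ 0 := Nat.cast_ne_zero.2 (Nat.choose_pos h).ne'
        have : (N.choose (a + 1) : ℝ) * ((a : ℝ) + 1) = N.choose a * ((N : ℝ) - a) := by
          have h0 := Nat.choose_succ_right_eq N a
          have h1 : ((N.choose (a + 1) * (a + 1) : ℕ) : ℝ) = (N.choose a * (N - a) : ℕ) := by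
            rw [h0]
          push_cast [h.le] at h1
          exact h1
        field_simp
        linear_combination -(bez N (a + 2) (b + 1)).eval x * this
      · rw [bez_eq_zero N (a + 1 + 1) _ (by omega)]; simp
    have s2 : (a : ℝ) * (zPoly N (a - 1) b).eval x
        = ((N : ℝ) + 1 - a) * ((N.choose a : ℝ) * (N.choose b : ℝ))⁻¹
          * (bez N a (b + 1)).eval x := by
      rcases a with _ | a
      · simp
      · rw [zPoly, eval_C_mul, Nat.add_sub_cancel]
        have q3 : (N.choose a : ℝ) ≠ 0 := Nat.cast_ne_zero.2 (Nat.choose_pos (by omega)).ne'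
        have : (N.choose (a + 1) : ℝ) * ((a : ℝ) + 1) = N.choose a * ((N : ℝ) - a) := by
          have h0 := Nat.choose_succ_right_eq N a
          have h1 : ((N.choose (a + 1) * (a + 1) : ℕ) : ℝ) = (N.choose a * (N - a) : ℕ) := by
            rw [h0]
          push_cast [show a ≤ N by omega] at h1
          exact h1
        push_cast
        field_simp
        linear_combination (bez N (a + 1) (b + 1)).eval x * this
    have s0 : ((N : ℝ) - a) / N * (scalarWeight x * (zPoly N (a + 1) b).eval x)
        = scalarWeight x / N * (((N : ℝ) - a) * (zPoly N (a + 1) b).eval x) := by ring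
    have s3 : (a : ℝ) / N * (scalarWeight x * (zPoly N (a - 1) b).eval x)
        = scalarWeight x / N * ((a : ℝ) * (zPoly N (a - 1) b).eval x) := by ring
    rw [s0, s3, s1, s2, zPoly, rowPoly, eval_C_mul, eval_C_mul, ← hrow]
    simp only [eval_sub, eval_mul, eval_add, eval_natCast, eval_X, eval_one, eval_ofNat]
    field_simp
  rw [← key]
  push_cast
  rfl

theorem rowPoly_antisymm (N n m : ℕ) : rowPoly N n m = -rowPoly N m n := by
  rw [rowPoly, rowPoly, bezRow_antisymm, mul_comm (N.choose n : ℝ), mul_neg]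

theorem coeffA1_mul_weight (N : ℕ) (hN : 0 < N) (x : ℝ) :
    evalAt (coeffA1 N) x * weight N x
      = -(weight N x * (evalAt (coeffA1 N) x).conjTranspose) := by
  have h : weight N x * (evalAt (coeffA1 N) x).conjTranspose
      = (evalAt (coeffA1 N) x * weight N x).conjTranspose := by
    rw [Matrix.conjTranspose_mul, weight_conjTranspose]
  rw [h]
  ext a b
  rw [Matrix.neg_apply, Matrix.conjTranspose_apply, coeffA1_mul_weight_apply N hN,
    coeffA1_mul_weight_apply N hN, rowPoly_antisymm]
  rw [Complex.star_def, Complex.conj_ofReal, ← Complex.ofReal_neg, eval_neg, mul_neg]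

/-- A₀ is real and diagonal, so entry (a,b) of the commutator-like right side is (N+2)(a-b)/N times
the weight entry. This is the factor in `bezRow_derivative` after rescaling. -/
theorem hasDerivAt_coeffA1_mul_weight (N : ℕ) (hN : 0 < N) {x : ℝ}
    (hx : x ∈ Set.Ioo (-1 : ℝ) 1) (a b : Fin (N + 1)) :
    HasDerivAt (fun y => (evalAt (coeffA1 N) y * weight N y) a b)
      ((coeffA0 N * weight N x - weight N x * (coeffA0 N).conjTranspose) a b) x := by
  simp only [coeffA1_mul_weight_apply N hN]
  have hN' : (N : ℝ) ≠ 0 := Nat.cast_ne_zero.2 hN.ne'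
  have h1 : 0 < 1 - x := by linarith [hx.2]
  have h2 : 0 < 1 + x := by linarith [hx.1]
  have hw : 0 < scalarWeight x := mul_pos (Real.sqrt_pos.2 h1) (Real.sqrt_pos.2 h2)
  have hw2 : scalarWeight x ^ 2 = 1 - x ^ 2 := by
    rw [scalarWeight, mul_pow, Real.sq_sqrt h1.le, Real.sq_sqrt h2.le]; ring
  have hd := congrArg (eval x) (bezRow_derivative N a b)
  simp only [eval_sub, eval_mul, eval_add, eval_natCast, eval_X, eval_one, eval_ofNat, eval_pow,
    eval_zero] at hd
  refine ((hasDerivAt_scalarWeight hx).mul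
    (Polynomial.hasDerivAt (rowPoly N a b) x)).ofReal_comp.congr_deriv ?_
  rw [Matrix.sub_apply, coeffA0_eq, Matrix.diagonal_mul, Matrix.diagonal_conjTranspose,
    Matrix.mul_diagonal, weight_apply]
  have hstar : (star fun a : Fin (N + 1) => (((N : ℂ) + 2) * (((a : ℕ) : ℂ) - N)) / N) b
      = (((N : ℂ) + 2) * (((b : ℕ) : ℂ) - N)) / N := by simp
  rw [hstar]
  have key : -x / scalarWeight x * (rowPoly N a b).eval x
      + scalarWeight x * (derivative (rowPoly N a b)).eval x
      = (((N : ℝ) + 2) * (((a : ℕ) : ℝ) - N)) / N * (scalarWeight x * (zPoly N a b).eval x)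
        - scalarWeight x * (zPoly N a b).eval x * ((((N : ℝ) + 2) * (((b : ℕ) : ℝ) - N)) / N) := by
    have q1 : (N.choose a : ℝ) ≠ 0 :=
      Nat.cast_ne_zero.2 (Nat.choose_pos (Nat.lt_succ_iff.1 a.2)).ne'
    have q2 : (N.choose b : ℝ) ≠ 0 :=
      Nat.cast_ne_zero.2 (Nat.choose_pos (Nat.lt_succ_iff.1 b.2)).ne'
    rw [← hw2] at hd
    rw [rowPoly, zPoly, derivative_C_mul, eval_C_mul, eval_C_mul, eval_C_mul]
    have := hw.ne'
    field_simp
    linear_combination -hd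
  rw [key]
  push_cast
  ring

/-! ### Positivity of the weight -/

/-- The polynomial `(1 + sX)^i (1 + s⁻¹X)^j`. -/
def binomProd (s : ℂ) (i j : ℕ) : ℂ[X] := (1 + C s * X) ^ i * (1 + C s⁻¹ * X) ^ j

theorem coeff_one_add_C_mul_X_pow (s : ℂ) (n k : ℕ) :
    ((1 + C s * X) ^ n : ℂ[X]).coeff k = (n.choose k : ℂ) * s ^ k := by
  have : ((1 + C s * X) ^ n : ℂ[X]) = ((1 + X) ^ n : ℂ[X]).comp (C s * X) := by simp
  rw [this, comp_C_mul_X_coeff, coeff_one_add_X_pow]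

theorem coeff_one_add_C_mul_X_mul_zero (s : ℂ) (p : ℂ[X]) :
    ((1 + C s * X) * p).coeff 0 = p.coeff 0 := by
  simp [mul_coeff_zero]

theorem coeff_one_add_C_mul_X_mul_succ (s : ℂ) (p : ℂ[X]) (n : ℕ) :
    ((1 + C s * X) * p).coeff (n + 1) = p.coeff (n + 1) + s * p.coeff n := by
  rw [add_mul, one_mul, mul_assoc, coeff_add, coeff_C_mul, coeff_X_mul]

/-- The sums `∑_j [z^n](1+sz)^j(1+s⁻¹z)^{N-j} · [w^m](1+s⁻¹w)^j(1+sw)^{N-j}`. -/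
def binomKernel (s : ℂ) (N n m : ℕ) : ℂ :=
  ∑ j ∈ Finset.range (N + 1),
    (binomProd s j (N - j)).coeff n * (binomProd s⁻¹ j (N - j)).coeff m

/-- Multiplying the j-th product by (1+sz)(1+y/s) or by (1+z/s)(1+sy) gives the (j+1)-st or j-th
product of total degree N+1. The difference of the two multipliers is (s-1/s)(z-y), so this exhibits
the kernel as a Bezoutian. -/
theorem binomProd_telescope (s : ℂ) (N n m : ℕ) :
    ∑ j ∈ Finset.range (N + 1), (((1 + C s * X) * binomProd s j (N - j)).coeff n
        * ((1 + C s⁻¹ * X) * binomProd s⁻¹ j (N - j)).coeff m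
      - ((1 + C s⁻¹ * X) * binomProd s j (N - j)).coeff n
        * ((1 + C s * X) * binomProd s⁻¹ j (N - j)).coeff m)
    = ((N + 1).choose n : ℂ) * ((N + 1).choose m : ℂ)
      * (s ^ n * s⁻¹ ^ m - s⁻¹ ^ n * s ^ m) := by
  have h := Finset.sum_range_sub (fun j => (binomProd s j (N + 1 - j)).coeff n
    * (binomProd s⁻¹ j (N + 1 - j)).coeff m) (N + 1)
  have e : ∀ j ∈ Finset.range (N + 1), ((1 + C s * X) * binomProd s j (N - j)).coeff n
        * ((1 + C s⁻¹ * X) * binomProd s⁻¹ j (N - j)).coeff m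
      - ((1 + C s⁻¹ * X) * binomProd s j (N - j)).coeff n
        * ((1 + C s * X) * binomProd s⁻¹ j (N - j)).coeff m
      = (binomProd s (j + 1) (N + 1 - (j + 1))).coeff n
          * (binomProd s⁻¹ (j + 1) (N + 1 - (j + 1))).coeff m
        - (binomProd s j (N + 1 - j)).coeff n * (binomProd s⁻¹ j (N + 1 - j)).coeff m := by
    intro j hj
    have hj' : N + 1 - j = N - j + 1 := by have := Finset.mem_range.1 hj; omega
    have g1 : ∀ r : ℂ, (1 + C r * X) * binomProd r j (N - j)
        = binomProd r (j + 1) (N + 1 - (j + 1)) := fun r => by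
      rw [Nat.add_sub_add_right, binomProd, binomProd, pow_succ]; ring
    have g2 : ∀ r : ℂ, (1 + C r⁻¹ * X) * binomProd r j (N - j)
        = binomProd r j (N + 1 - j) := fun r => by
      rw [hj', binomProd, binomProd, pow_succ]; ring
    have g2' := g2 s⁻¹
    rw [inv_inv] at g2'
    rw [g1, g1, g2, g2']
  rw [Finset.sum_congr rfl e, h]
  simp only [Nat.sub_self, Nat.sub_zero, binomProd, pow_zero, mul_one, one_mul, inv_inv,
    coeff_one_add_C_mul_X_pow]
  ring

theorem binomKernel_zero (s : ℂ) (N n : ℕ) :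
    (s - s⁻¹) * binomKernel s N n 0
      = ((N + 1).choose (n + 1) : ℂ) * (s ^ (n + 1) - s⁻¹ ^ (n + 1)) := by
  have h := binomProd_telescope s N (n + 1) 0
  simp only [coeff_one_add_C_mul_X_mul_zero, coeff_one_add_C_mul_X_mul_succ, Nat.choose_zero_right,
    pow_zero, mul_one, Nat.cast_one] at h
  rw [← h, binomKernel, Finset.mul_sum]
  exact Finset.sum_congr rfl fun j _ => by ring

theorem binomKernel_succ (s : ℂ) (N n m : ℕ) :
    (s - s⁻¹) * binomKernel s N n (m + 1) = (s - s⁻¹) * binomKernel s N (n + 1) m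
      + ((N + 1).choose (n + 1) : ℂ) * ((N + 1).choose (m + 1) : ℂ)
      * (s ^ (n + 1) * s⁻¹ ^ (m + 1) - s⁻¹ ^ (n + 1) * s ^ (m + 1)) := by
  rw [← binomProd_telescope, binomKernel, binomKernel, Finset.mul_sum, Finset.mul_sum,
    ← Finset.sum_add_distrib]
  refine Finset.sum_congr rfl fun j _ => ?_
  simp only [coeff_one_add_C_mul_X_mul_succ]
  ring

theorem exp_sub_inv_mul_U (θ : ℝ) (k : ℤ) :
    (Complex.exp (θ * Complex.I) - (Complex.exp (θ * Complex.I))⁻¹)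
        * (((Chebyshev.U ℝ (k - 1)).eval (Real.cos θ) : ℝ) : ℂ)
      = Complex.exp (θ * Complex.I) ^ k - (Complex.exp (θ * Complex.I))⁻¹ ^ k := by
  have h := congrArg (fun r : ℝ => (r : ℂ)) (Chebyshev.U_real_cos θ (k - 1))
  push_cast at h
  rw [sub_add_cancel] at h
  rw [inv_zpow, ← Complex.exp_int_mul, ← Complex.exp_neg, ← Complex.exp_neg]
  have e : ∀ z : ℂ, Complex.exp (z * Complex.I) - Complex.exp (-(z * Complex.I))
      = 2 * Complex.I * Complex.sin z := fun z => by
    rw [Complex.sin, neg_mul]; linear_combination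
      (-(Complex.exp (-(z * Complex.I)) - Complex.exp (z * Complex.I))) * Complex.I_sq
  rw [e, ← mul_assoc (k : ℂ), e]
  push_cast
  linear_combination 2 * Complex.I * h

/-- Both sides, times s - 1/s, satisfy the same recursion moving one unit from the second index to
the first (`binomKernel_succ`), with the same values at m = 0. -/
theorem bez_eval_cos (N : ℕ) (θ : ℝ) (hθ : Real.sin θ ≠ 0) (m n : ℕ) :
    (((bez N (n + 1) (m + 1)).eval (Real.cos θ) : ℝ) : ℂ)
      = binomKernel (Complex.exp (θ * Complex.I)) N n m := by
  set s := Complex.exp (θ * Complex.I) with hs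
  have hs0 : s ≠ 0 := Complex.exp_ne_zero _
  have hne : s - s⁻¹ ≠ 0 := by
    intro h0
    apply hθ
    rw [hs, ← Complex.exp_neg] at h0
    have : Complex.sin θ = 0 := by
      rw [Complex.sin, neg_mul]; linear_combination (-Complex.I / 2) * h0
    exact_mod_cast this
  apply mul_left_cancel₀ hne
  induction m generalizing n with
  | zero =>
    have h := exp_sub_inv_mul_U θ ((n + 1 : ℕ) : ℤ)
    rw [zpow_natCast, zpow_natCast] at h
    rw [binomKernel_zero, ← h, bez, ← hs]
    simp only [zero_add, Finset.sum_range_one, Nat.choose_zero_right, Nat.add_sub_cancel,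
      Nat.sub_zero, eval_mul, eval_natCast, Nat.cast_one, one_mul, Nat.cast_zero, mul_zero, sub_zero]
    rw [show ((n + 1 : ℕ) : ℤ) + 1 - 2 = ((n + 1 : ℕ) : ℤ) - 1 by ring]
    push_cast
    ring
  | succ m ih =>
    have e : bez N (n + 1) (m + 1 + 1) = bez N (n + 1 + 1) (m + 1)
        + ((N + 1).choose (m + 1) : ℝ[X]) * ((N + 1).choose (n + 1) : ℝ[X])
          * Chebyshev.U ℝ (((n : ℤ) - m) - 1) := by
      rw [bez, Finset.sum_range_succ, bez]
      congr 1
      · refine Finset.sum_congr rfl fun t _ => ?_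
        rw [show n + 1 + (m + 1 + 1) = n + 1 + 1 + (m + 1) by ring,
          show ((n + 1 : ℕ) : ℤ) + ((m + 1 + 1 : ℕ) : ℤ)
            = ((n + 1 + 1 : ℕ) : ℤ) + ((m + 1 : ℕ) : ℤ) by push_cast; ring]
      · rw [show n + 1 + (m + 1 + 1) - 1 - (m + 1) = n + 1 by omega,
          show ((n + 1 : ℕ) : ℤ) + ((m + 1 + 1 : ℕ) : ℤ) - 2 - 2 * ((m + 1 : ℕ) : ℤ)
            = (n : ℤ) - m - 1 by push_cast; ring]
    have h := exp_sub_inv_mul_U θ ((n : ℤ) - m)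
    rw [← hs, zpow_sub₀ hs0, zpow_sub₀ (inv_ne_zero hs0)] at h
    simp only [zpow_natCast] at h
    have hpow : s ^ (n + 1) * s⁻¹ ^ (m + 1) - s⁻¹ ^ (n + 1) * s ^ (m + 1)
        = s ^ n / s ^ m - s⁻¹ ^ n / s⁻¹ ^ m := by
      simp only [inv_pow, pow_succ]
      field_simp
    rw [binomKernel_succ, ← ih, e, hpow, ← h]
    simp only [eval_add, eval_mul, eval_natCast]
    push_cast
    ring

theorem X_pow_mem_span_binomProd (s : ℂ) (hs : s - s⁻¹ ≠ 0) (k n : ℕ) (hn : n ≤ k) :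
    (X ^ n : ℂ[X]) ∈ Submodule.span ℂ {p : ℂ[X] | ∃ i j, i + j = k ∧ p = binomProd s i j} := by
  have step : ∀ (k : ℕ) (r q : ℂ) (p : ℂ[X]),
      p ∈ Submodule.span ℂ {p : ℂ[X] | ∃ i j, i + j = k ∧ p = binomProd s i j} →
      (C r * (1 + C s * X) + C q * (1 + C s⁻¹ * X)) * p
        ∈ Submodule.span ℂ {p : ℂ[X] | ∃ i j, i + j = k + 1 ∧ p = binomProd s i j} := by
    intro k r q p hp
    induction hp using Submodule.span_induction with
    | mem p hp =>
      obtain ⟨i, j, hij, rfl⟩ := hp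
      have : (C r * (1 + C s * X) + C q * (1 + C s⁻¹ * X)) * binomProd s i j
          = r • binomProd s (i + 1) j + q • binomProd s i (j + 1) := by
        rw [smul_eq_C_mul, smul_eq_C_mul, binomProd, binomProd, binomProd]; ring
      rw [this]
      exact add_mem (Submodule.smul_mem _ _ (Submodule.subset_span ⟨i + 1, j, by omega, rfl⟩))
        (Submodule.smul_mem _ _ (Submodule.subset_span ⟨i, j + 1, by omega, rfl⟩))
    | zero => simp
    | add p p' _ _ h h' => rw [mul_add]; exact add_mem h h'
    | smul c p _ h => rw [mul_smul_comm]; exact Submodule.smul_mem _ _ h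
  have hs0 : s ≠ 0 := by rintro rfl; simp at hs
  induction k generalizing n with
  | zero =>
    obtain rfl : n = 0 := by omega
    exact Submodule.subset_span ⟨0, 0, rfl, by simp [binomProd]⟩
  | succ k ih =>
    have hC : (C (s - s⁻¹)⁻¹ * (C s - C s⁻¹) : ℂ[X]) = 1 := by
      rw [← C_sub, ← C_mul, inv_mul_cancel₀ hs, C_1]
    have hss : (C s * C s⁻¹ : ℂ[X]) = 1 := by rw [← C_mul, mul_inv_cancel₀ hs0, C_1]
    rcases Nat.lt_or_ge n (k + 1) with h | h
    -- These coefficients combine the two linear factors to the constant 1, raising k without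
    -- changing the power; the pair in the other case combines them to X.
    · have := step k (-(s - s⁻¹)⁻¹ * s⁻¹) ((s - s⁻¹)⁻¹ * s) _ (ih n (by omega))
      convert this using 1
      simp only [C_mul, C_neg]
      linear_combination -(X ^ n : ℂ[X]) * hC
    · obtain rfl : n = k + 1 := by omega
      have := step k ((s - s⁻¹)⁻¹) (-(s - s⁻¹)⁻¹) _ (ih k le_rfl)
      convert this using 1
      simp only [C_neg]
      linear_combination -(X ^ (k + 1) : ℂ[X]) * hC

-- On the unit circle conjugation exchanges s and 1/s, so the kernel is BB^* and W = MM^* with M a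
-- row rescaling of B. A row vector annihilated by M defines a functional on coefficients that kills
-- every (1+sX)^j(1+X/s)^{N-j}, hence every X^n with n ≤ N.
open scoped ComplexOrder in
theorem weight_posDef (N : ℕ) {x : ℝ} (hx : x ∈ Set.Ioo (-1 : ℝ) 1) : (weight N x).PosDef := by
  have h1 : 0 < 1 - x := by linarith [hx.2]
  have h2 : 0 < 1 + x := by linarith [hx.1]
  have hw : 0 < scalarWeight x := mul_pos (Real.sqrt_pos.2 h1) (Real.sqrt_pos.2 h2)
  set θ := Real.arccos x with hθdef
  have hcos : Real.cos θ = x := Real.cos_arccos hx.1.le hx.2.le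
  have hθ : Real.sin θ ≠ 0 := by
    rw [hθdef, Real.sin_arccos]
    exact (Real.sqrt_pos.2 (by nlinarith)).ne'
  set s := Complex.exp (θ * Complex.I) with hs
  have hs0 : s ≠ 0 := Complex.exp_ne_zero _
  have hconj : (starRingEnd ℂ) s = s⁻¹ := by
    rw [hs, ← Complex.exp_conj, ← Complex.exp_neg]
    simp
  have hne : s - s⁻¹ ≠ 0 := by
    intro h0
    apply hθ
    rw [hs, ← Complex.exp_neg] at h0
    have : Complex.sin θ = 0 := by
      rw [Complex.sin, neg_mul]; linear_combination (-Complex.I / 2) * h0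
    exact_mod_cast this
  have hconjB : ∀ i j n, (starRingEnd ℂ) ((binomProd s i j).coeff n)
      = (binomProd s⁻¹ i j).coeff n := by
    intro i j n
    rw [← coeff_map]
    congr 1
    simp [binomProd, Polynomial.map_mul, Polynomial.map_pow, hconj]
  let c : Fin (N + 1) → ℝ := fun n => Real.sqrt (scalarWeight x) / (N.choose n : ℝ)
  have hc : ∀ n, c n ≠ 0 := fun n => div_ne_zero (Real.sqrt_pos.2 hw).ne'
    (Nat.cast_ne_zero.2 (Nat.choose_pos (Nat.lt_succ_iff.1 n.2)).ne')
  let M : Matrix (Fin (N + 1)) (Fin (N + 1)) ℂ :=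
    Matrix.of fun n j => (c n : ℂ) * (binomProd s j (N - j)).coeff n
  have hM : weight N x = M * M.conjTranspose := by
    ext n m
    rw [weight_apply, Matrix.mul_apply, zPoly, eval_C_mul]
    have hb := bez_eval_cos N θ hθ m n
    rw [hcos, ← hs] at hb
    have e : ∀ j : Fin (N + 1), M n j * M.conjTranspose j m = (c n : ℂ) * c m
        * ((binomProd s j (N - j)).coeff n * (binomProd s⁻¹ j (N - j)).coeff m) := by
      intro j
      simp only [M, Matrix.conjTranspose_apply, Matrix.of_apply, Complex.star_def, map_mul,
        hconjB, Complex.conj_ofReal]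
      ring
    rw [Finset.sum_congr rfl fun j _ => e j, ← Finset.mul_sum,
      Fin.sum_univ_eq_sum_range (fun j => (binomProd s j (N - j)).coeff n
        * (binomProd s⁻¹ j (N - j)).coeff m) (N + 1), ← binomKernel, ← hb,
      ← Complex.ofReal_mul, ← Complex.ofReal_mul]
    congr 1
    have hsq := Real.mul_self_sqrt hw.le
    simp only [c]
    rw [div_mul_div_comm, hsq]
    ring
  rw [hM]
  refine Matrix.PosDef.mul_conjTranspose_self M ?_
  intro v v' hv
  rw [← sub_eq_zero]
  set u := v - v' with hu
  have hu0 : Matrix.vecMul u M = 0 := by rw [hu, Matrix.sub_vecMul, sub_eq_zero]; exact hv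
  let f : ℂ[X] →ₗ[ℂ] ℂ := ∑ n : Fin (N + 1), (u n * c n) • lcoeff ℂ (n : ℕ)
  have hf : ∀ p : ℂ[X], f p = ∑ n : Fin (N + 1), u n * c n * p.coeff n := fun p => by
    simp [f, LinearMap.sum_apply]
  have hker : Submodule.span ℂ {p : ℂ[X] | ∃ i j, i + j = N ∧ p = binomProd s i j}
      ≤ LinearMap.ker f := by
    rw [Submodule.span_le]
    rintro _ ⟨i, j, hij, rfl⟩
    have h0 := congrFun hu0 ⟨i, by omega⟩
    have hj : j = N - i := by omega
    rw [SetLike.mem_coe, LinearMap.mem_ker, hf, hj]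
    refine Eq.trans ?_ h0
    simp only [Matrix.vecMul, dotProduct, M, Matrix.of_apply]
    exact Finset.sum_congr rfl fun n _ => by ring
  ext n
  have h0 := hker (X_pow_mem_span_binomProd s hne N n (Nat.lt_succ_iff.1 n.2))
  rw [LinearMap.mem_ker, hf, Finset.sum_eq_single n] at h0
  · rw [coeff_X_pow_self, mul_one] at h0
    exact (mul_eq_zero.1 h0).resolve_right (Complex.ofReal_ne_zero.2 (hc n))
  · intro b _ hb
    rw [coeff_X_pow, if_neg (fun h => hb (Fin.ext h)), mul_zero]
  · simp

/-! ### The matrix valued pairing -/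

section General

variable {ι : Type} [Fintype ι] [DecidableEq ι]

theorem hasDerivAt_evalAt (P : (Matrix ι ι ℂ)[X]) (x : ℝ) (i j : ι) :
    HasDerivAt (fun y => evalAt P y i j) (evalAt (derivative P) x i j) x := by
  induction P using Polynomial.induction_on' with
  | add P Q hP hQ =>
    simp only [derivative_add, evalAt_add, Matrix.add_apply]
    exact hP.add hQ
  | monomial n M =>
    have h : ∀ (k : ℕ) (A : Matrix ι ι ℂ) (y : ℝ), evalAt (monomial k A) y i j
        = (y : ℂ) ^ k * A i j := by
      intro k A y
      rw [evalAt, eval_monomial, ← map_pow, ← Algebra.commutes, ← Algebra.smul_def,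
        Matrix.smul_apply, smul_eq_mul]
    rw [derivative_monomial]
    simp only [h]
    have hd := (((hasDerivAt_id x).ofReal_comp).pow n).mul_const (M i j)
    have hn : (M * (n : Matrix ι ι ℂ)) i j = n * M i j := by
      rw [← Nat.cast_comm, ← nsmul_eq_mul, Matrix.smul_apply, nsmul_eq_mul]
    refine hd.congr_deriv ?_
    rw [hn]
    simp
    ring

theorem continuous_evalAt (P : (Matrix ι ι ℂ)[X]) : Continuous fun x => evalAt P x :=
  continuous_matrix fun i j =>
    continuous_iff_continuousAt.2 fun x => (hasDerivAt_evalAt P x i j).continuousAt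

theorem hasDerivAt_matrix_mul {A B : ℝ → Matrix ι ι ℂ} {A' B' : Matrix ι ι ℂ} {x : ℝ}
    (hA : ∀ i j, HasDerivAt (fun y => A y i j) (A' i j) x)
    (hB : ∀ i j, HasDerivAt (fun y => B y i j) (B' i j) x) (i j : ι) :
    HasDerivAt (fun y => (A y * B y) i j) ((A' * B x + A x * B') i j) x := by
  simp only [Matrix.mul_apply, Matrix.add_apply, ← Finset.sum_add_distrib]
  exact HasDerivAt.fun_sum fun k _ => (hA i k).mul (hB k j)

variable {W : ℝ → Matrix ι ι ℂ}

theorem continuous_integrand (hW : Continuous W) (P Q : (Matrix ι ι ℂ)[X]) :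
    Continuous fun x => evalAt P x * W x * (evalAt Q x).conjTranspose :=
  ((continuous_evalAt P).matrix_mul hW).matrix_mul (continuous_evalAt Q).matrix_conjTranspose

theorem intervalIntegrable_integrand (hW : Continuous W) (P Q : (Matrix ι ι ℂ)[X]) (i j : ι)
    (a b : ℝ) :
    IntervalIntegrable (fun x => (evalAt P x * W x * (evalAt Q x).conjTranspose) i j)
      MeasureTheory.volume a b :=
  ((continuous_integrand hW P Q).matrix_elem i j).intervalIntegrable a b

theorem pairing_add_right (hW : Continuous W) (P Q R : (Matrix ι ι ℂ)[X]) :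
    pairing W P (Q + R) = pairing W P Q + pairing W P R := by
  ext i j
  simp only [pairing, Matrix.of_apply, Matrix.add_apply]
  rw [← intervalIntegral.integral_add (intervalIntegrable_integrand hW P Q i j _ _)
    (intervalIntegrable_integrand hW P R i j _ _)]
  simp only [evalAt_add, Matrix.conjTranspose_add, mul_add, Matrix.add_apply]

theorem pairing_sub_left (hW : Continuous W) (P Q R : (Matrix ι ι ℂ)[X]) :
    pairing W (P - Q) R = pairing W P R - pairing W Q R := by
  ext i j
  simp only [pairing, Matrix.of_apply, Matrix.sub_apply]
  rw [← intervalIntegral.integral_sub (intervalIntegrable_integrand hW P R i j _ _)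
    (intervalIntegrable_integrand hW Q R i j _ _)]
  simp only [evalAt_sub, sub_mul, Matrix.sub_apply]

theorem pairing_C_mul_left (hW : Continuous W) (A : Matrix ι ι ℂ) (P Q : (Matrix ι ι ℂ)[X]) :
    pairing W (C A * P) Q = A * pairing W P Q := by
  ext i j
  rw [Matrix.mul_apply]
  simp only [pairing, Matrix.of_apply]
  simp only [← intervalIntegral.integral_const_mul]
  rw [← intervalIntegral.integral_finsetSum fun k _ =>
    (intervalIntegrable_integrand hW P Q k j _ _).const_mul (A i k)]
  simp only [evalAt_mul, evalAt_C, mul_assoc, Matrix.mul_apply (M := A)]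

theorem pairing_C_mul_right (hW : Continuous W) (A : Matrix ι ι ℂ) (P Q : (Matrix ι ι ℂ)[X]) :
    pairing W P (C A * Q) = pairing W P Q * A.conjTranspose := by
  ext i j
  rw [Matrix.mul_apply]
  simp only [pairing, Matrix.of_apply]
  simp only [← intervalIntegral.integral_mul_const]
  rw [← intervalIntegral.integral_finsetSum fun k _ =>
    (intervalIntegrable_integrand hW P Q i k _ _).mul_const (A.conjTranspose k j)]
  simp only [evalAt_mul, evalAt_C, Matrix.conjTranspose_mul, ← mul_assoc,
    Matrix.mul_apply (N := A.conjTranspose)]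

theorem pairing_zero_right (P : (Matrix ι ι ℂ)[X]) : pairing W P 0 = 0 := by
  ext i j
  simp [pairing, evalAt]

/-- Seen as a matrix of polynomials, each entry has infinitely many roots. -/
theorem eq_zero_of_evalAt_eq_zero {Q : (Matrix ι ι ℂ)[X]}
    (h : ∀ x ∈ Set.Ioo (-1 : ℝ) 1, evalAt Q x = 0) : Q = 0 := by
  have hM : matPolyEquiv.symm Q = (0 : Matrix ι ι ℂ[X]) := by
    ext1 i j
    refine Polynomial.eq_zero_of_infinite_isRoot _ (Set.Infinite.mono ?_
      ((Set.Ioo_infinite (show (-1 : ℝ) < 1 by norm_num)).image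
        (Complex.ofReal_injective.injOn)))
    rintro _ ⟨x, hx, rfl⟩
    have := matPolyEquiv_eval (matPolyEquiv.symm Q) (x : ℂ) i j
    rw [AlgEquiv.apply_symm_apply] at this
    rw [Set.mem_ofPred_eq, IsRoot, ← this]
    exact congrFun (congrFun (h x hx) i) j
  simpa using hM

open scoped ComplexOrder in
/-- The pairing of a weight that is positive definite on `(-1,1)` is definite. -/
theorem eq_zero_of_pairing_self (hW : Continuous W)
    (hpos : ∀ x ∈ Set.Ioo (-1 : ℝ) 1, (W x).PosDef) {Q : (Matrix ι ι ℂ)[X]}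
    (h : pairing W Q Q = 0) : Q = 0 := by
  refine eq_zero_of_evalAt_eq_zero fun x hx => ?_
  ext1 i
  by_contra hrow
  have hentry : ∀ y, (evalAt Q y * W y * (evalAt Q y).conjTranspose) i i
      = star (star (evalAt Q y i)) ⬝ᵥ (W y).mulVec (star (evalAt Q y i)) := by
    intro y
    rw [star_star, Matrix.mul_assoc, Matrix.mul_apply']
    congr 1
  have hcont : Continuous fun y =>
      ((evalAt Q y * W y * (evalAt Q y).conjTranspose) i i).re :=
    Complex.continuous_re.comp ((continuous_integrand hW Q Q).matrix_elem i i)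
  have hnonneg : ∀ y ∈ Set.Ioo (-1 : ℝ) 1,
      0 ≤ ((evalAt Q y * W y * (evalAt Q y).conjTranspose) i i).re := by
    intro y hy
    rw [hentry]
    exact (Complex.le_def.1 ((hpos y hy).posSemidef.dotProduct_mulVec_nonneg _)).1
  have hpt : 0 < ((evalAt Q x * W x * (evalAt Q x).conjTranspose) i i).re := by
    rw [hentry]
    refine (Complex.lt_def.1 ((hpos x hx).dotProduct_mulVec_pos ?_)).1
    exact fun h0 => hrow (congrFun (star_eq_zero.1 h0))
  have hint : ∫ y in (-1 : ℝ)..1,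
      ((evalAt Q y * W y * (evalAt Q y).conjTranspose) i i).re = 0 := by
    have h1 := Complex.reCLM.intervalIntegral_comp_comm
      (intervalIntegrable_integrand hW Q Q i i (-1) 1)
    have h2 := congrFun (congrFun h i) i
    simp only [pairing, Matrix.of_apply, Matrix.zero_apply] at h2
    rw [h2, map_zero] at h1
    exact h1
  -- Positive definiteness is assumed only on the open interval; continuity extends nonnegativity to
  -- the endpoint 1.
  have hclosed : ∀ y ∈ Set.Ioc (-1 : ℝ) 1,
      0 ≤ ((evalAt Q y * W y * (evalAt Q y).conjTranspose) i i).re := by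
    intro y hy
    have hcl : y ∈ closure (Set.Ioo (-1 : ℝ) 1) := by
      rw [closure_Ioo (by norm_num)]; exact Set.Ioc_subset_Icc_self hy
    exact (isClosed_le continuous_const hcont).closure_subset_iff.2 hnonneg hcl
  exact (intervalIntegral.integral_pos (by norm_num) hcont.continuousOn hclosed
    ⟨x, Set.Ioo_subset_Icc_self hx, hpt⟩).ne' hint

theorem pairing_eq_zero_of_degree_lt (hW : Continuous W) {R : ℕ → (Matrix ι ι ℂ)[X]}
    (hR : IsOrthogonalSeq W R) {k n : ℕ} (hk : k ≤ n) {S : (Matrix ι ι ℂ)[X]}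
    (hS : S.degree < k) : pairing W (R n) S = 0 := by
  induction k generalizing S with
  | zero =>
    have : S = 0 := by
      ext1 j; simpa using (degree_lt_iff_coeff_zero S 0).1 hS j (Nat.zero_le j)
    rw [this, pairing_zero_right]
  | succ k ih =>
    obtain ⟨B, hB⟩ := (hR.isUnit_leadingCoeff k).exists_left_inv
    have hlead : (R k).leadingCoeff = (R k).coeff k := by
      rw [leadingCoeff, hR.natDegree_eq]
    -- Subtracting this left multiple of R_k cancels the top coefficient of S, since B is a left
    -- inverse of the leading coefficient.
    have hS' : (S - C (S.coeff k * B) * R k).degree < k := by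
      rw [degree_lt_iff_coeff_zero]
      intro j hj
      rw [coeff_sub, coeff_C_mul]
      rcases hj.eq_or_lt with rfl | hj
      · rw [← hlead, mul_assoc, hB, mul_one, sub_self]
      · rw [(degree_lt_iff_coeff_zero S _).1 hS j hj,
          coeff_eq_zero_of_natDegree_lt (p := R k) (by rw [hR.natDegree_eq]; exact hj), mul_zero, sub_zero]
    have hsplit : S = (S - C (S.coeff k * B) * R k) + C (S.coeff k * B) * R k := by
      rw [sub_add_cancel]
    rw [hsplit, pairing_add_right hW, ih (by omega) hS', pairing_C_mul_right hW,
      hR.orthogonal n k (by omega), zero_mul, add_zero]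

/-- A symmetric operator that does not raise degrees has the orthogonal polynomials as
eigenfunctions. -/
theorem actRight_eq_of_symmetric (hW : Continuous W)
    (hdef : ∀ Q : (Matrix ι ι ℂ)[X], pairing W Q Q = 0 → Q = 0) {D : RightDiffOp ι}
    (hD : ∀ P Q : (Matrix ι ι ℂ)[X], pairing W (actRight P D) Q = pairing W P (actRight Q D))
    (hdeg : ∀ (Q : (Matrix ι ι ℂ)[X]) (k : ℕ), Q.degree < k → (actRight Q D).degree < k)
    {R : ℕ → (Matrix ι ι ℂ)[X]} (hR : IsOrthogonalSeq W R) {n : ℕ} {Γ : Matrix ι ι ℂ}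
    (hΓ : (actRight (R n) D).coeff n = Γ * (R n).leadingCoeff) :
    actRight (R n) D = C Γ * R n := by
  have hlt : (actRight (R n) D - C Γ * R n).degree < n := by
    rw [degree_lt_iff_coeff_zero]
    intro j hj
    rw [coeff_sub, coeff_C_mul]
    rcases hj.eq_or_lt with rfl | hj
    · rw [hΓ, leadingCoeff, hR.natDegree_eq, sub_self]
    · have h1 : (R n).degree < (n + 1 : ℕ) := by
        rw [degree_lt_iff_coeff_zero]
        intro l hl
        exact coeff_eq_zero_of_natDegree_lt (by rw [hR.natDegree_eq]; omega)
      rw [(degree_lt_iff_coeff_zero _ _).1 (hdeg _ _ h1) j hj,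
        (degree_lt_iff_coeff_zero _ _).1 h1 j hj, mul_zero, sub_zero]
  -- For Δ = R_nD - ΓR_n, symmetry gives ⟨Δ,Δ⟩ = ⟨R_n,ΔD⟩ - Γ⟨R_n,Δ⟩, and both Δ and ΔD have degree
  -- below n.
  refine sub_eq_zero.1 (hdef _ ?_)
  rw [pairing_sub_left hW, pairing_C_mul_left hW, hD,
    pairing_eq_zero_of_degree_lt hW hR le_rfl (hdeg _ _ hlt),
    pairing_eq_zero_of_degree_lt hW hR le_rfl hlt, mul_zero, sub_zero]

end General

/-! ### The first order operator -/

theorem actRight_opE (N : ℕ) (P : (Matrix (Fin (N + 1)) (Fin (N + 1)) ℂ)[X]) :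
    actRight P (opE N) = derivative P * coeffA1 N + P * C (coeffA0 N) := by
  rw [actRight, opE, Finsupp.sum_add_index' (by simp) (fun _ _ _ => mul_add _ _ _),
    Finsupp.sum_single_index (by simp), Finsupp.sum_single_index (by simp)]
  simp

theorem opE_symmetric (N : ℕ) (hN : 0 < N) (P Q : (Matrix (Fin (N + 1)) (Fin (N + 1)) ℂ)[X]) :
    pairing (weight N) (actRight P (opE N)) Q = pairing (weight N) P (actRight Q (opE N)) := by
  have hW : Continuous (weight N) := continuous_matrix (continuous_weight N)
  ext i j
  simp only [pairing, Matrix.of_apply]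
  rw [← sub_eq_zero, ← intervalIntegral.integral_sub
    (intervalIntegrable_integrand hW _ _ i j _ _) (intervalIntegrable_integrand hW _ _ i j _ _)]
  have hcont : Continuous fun y => (evalAt P y * (evalAt (coeffA1 N) y * weight N y)
      * (evalAt Q y).conjTranspose) i j :=
    ((((continuous_evalAt P).matrix_mul ((continuous_evalAt _).matrix_mul hW)).matrix_mul
      (continuous_evalAt Q).matrix_conjTranspose)).matrix_elem i j
  -- The difference of the two integrands is the exact derivative of P A₁W Q^*. Only interior points
  -- are used, as the square roots are not differentiable at ±1.
  have hderiv : ∀ x ∈ Set.Ioo (-1 : ℝ) 1, HasDerivAt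
      (fun y => (evalAt P y * (evalAt (coeffA1 N) y * weight N y)
        * (evalAt Q y).conjTranspose) i j)
      ((evalAt (actRight P (opE N)) x * weight N x * (evalAt Q x).conjTranspose) i j
        - (evalAt P x * weight N x * (evalAt (actRight Q (opE N)) x).conjTranspose) i j) x := by
    intro x hx
    have hQ : ∀ k l, HasDerivAt (fun y => (evalAt Q y).conjTranspose k l)
        ((evalAt (derivative Q) x).conjTranspose k l) x := fun k l =>
      (hasDerivAt_evalAt Q x l k).star
    refine (hasDerivAt_matrix_mul (hasDerivAt_matrix_mul (hasDerivAt_evalAt P x)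
      (hasDerivAt_coeffA1_mul_weight N hN hx)) hQ i j).congr_deriv ?_
    rw [← Matrix.sub_apply]
    refine congrFun (congrFun ?_ i) j
    rw [actRight_opE, actRight_opE]
    simp only [evalAt_add, evalAt_mul, evalAt_C, Matrix.conjTranspose_add,
      Matrix.conjTranspose_mul]
    have h := coeffA1_mul_weight N hN x
    have h' : evalAt P x * (evalAt (coeffA1 N) x * weight N x)
          * (evalAt (derivative Q) x).conjTranspose
        = -(evalAt P x * weight N x * ((evalAt (coeffA1 N) x).conjTranspose
          * (evalAt (derivative Q) x).conjTranspose)) := by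
      rw [h]; noncomm_ring
    rw [h']
    noncomm_ring
  have hzero : ∀ y : ℝ, scalarWeight y = 0 → weight N y = 0 := by
    intro y hy; ext a b; rw [weight_apply, hy]; simp
  rw [intervalIntegral.integral_eq_sub_of_hasDerivAt_of_le (by norm_num) hcont.continuousOn hderiv
    ((intervalIntegrable_integrand hW _ _ i j _ _).sub
      (intervalIntegrable_integrand hW _ _ i j _ _)),
    hzero 1 (by simp [scalarWeight]), hzero (-1) (by simp [scalarWeight])]
  simp

/-- The coefficient of `x` in `A₁(x)`. -/
def coeffA1Lead (N : ℕ) : Matrix (Fin (N + 1)) (Fin (N + 1)) ℂ :=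
  -∑ i ∈ Finset.range (N + 1), (((N : ℂ) / 2 - i) / ((N : ℂ) / 2)) • elem N i i

theorem coeffA1_eq (N : ℕ) : ∃ B, coeffA1 N = C B + C (coeffA1Lead N) * X := by
  refine ⟨∑ i ∈ Finset.range (N + 1), (((N : ℂ) - i) / N) • elem N i (i + 1)
    - ∑ i ∈ Finset.range (N + 1), ((i : ℂ) / N) • elem N i (i - 1), ?_⟩
  simp only [coeffA1, coeffA1Lead, C_sub, C_neg, map_sum, X_mul_C]
  rw [sub_right_comm, sub_eq_add_neg, ← Finset.sum_mul]
  exact congrArg _ (neg_mul _ _).symm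

/-- The constant part of A₁ contributes only through the coefficient of degree n+1; when that
vanishes, only the x-coefficient of A₁ and A₀ remain. -/
theorem coeff_actRight_opE (N : ℕ) (P : (Matrix (Fin (N + 1)) (Fin (N + 1)) ℂ)[X]) (n : ℕ)
    (hP : P.coeff (n + 1) = 0) :
    (actRight P (opE N)).coeff n = P.coeff n * ((n : ℂ) • coeffA1Lead N + coeffA0 N) := by
  obtain ⟨B, hB⟩ := coeffA1_eq N
  rw [actRight_opE, hB, coeff_add, mul_add, coeff_add, coeff_mul_C, coeff_mul_C, coeff_derivative,
    hP, zero_mul, zero_mul, zero_add, mul_add, ← mul_assoc]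
  congr 1
  cases n with
  | zero => simp
  | succ n =>
    rw [coeff_mul_X, coeff_mul_C, coeff_derivative, mul_assoc, ← Nat.cast_succ,
      ← nsmul_eq_mul, Nat.cast_smul_eq_nsmul]

theorem degree_actRight_opE_lt (N : ℕ) (P : (Matrix (Fin (N + 1)) (Fin (N + 1)) ℂ)[X]) (k : ℕ)
    (hP : P.degree < k) : (actRight P (opE N)).degree < k := by
  rw [degree_lt_iff_coeff_zero] at hP ⊢
  intro j hj
  rw [coeff_actRight_opE N P j (hP _ (by omega)), hP j hj, zero_mul]

theorem eigenvalueE_eq (N n : ℕ) :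
    (n : ℂ) • coeffA1Lead N + coeffA0 N = eigenvalueE N n := by
  rw [coeffA1Lead, coeffA0, eigenvalueE, smul_neg, Finset.smul_sum, ← Finset.sum_neg_distrib,
    ← Finset.sum_add_distrib]
  refine Finset.sum_congr rfl fun i _ => ?_
  rw [smul_smul, ← neg_smul, ← add_smul]
  congr 1
  ring

theorem opE_mem_opAlgebra (N : ℕ) : opE N ∈ opAlgebra (Fin (N + 1)) := by
  intro i
  obtain ⟨B, hB⟩ := coeffA1_eq N
  rw [opE, Finsupp.add_apply]
  rcases i with _ | _ | i
  · simpa using degree_C_le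
  · simp only [zero_add, Finsupp.single_eq_same, hB]
    rw [Finsupp.single_eq_of_ne (by norm_num), add_zero]
    exact (degree_add_le _ _).trans (max_le (degree_C_le.trans (by norm_num)) (degree_C_mul_X_le _))
  · rw [Finsupp.single_eq_of_ne (by omega), Finsupp.single_eq_of_ne (by omega)]
    simp

end MVOP
end

/-! ### Symmetry, eigenfunctions and eigenvalues of E -/

theorem mainTheorem5 (N : ℕ) (hN : 0 < N) :
    MVOP.IsSymmetricOp (MVOP.weight N) (MVOP.opE N) ∧
    MVOP.opE N ∈ MVOP.eigenAlgebra (MVOP.weight N) ∧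
    ∀ P : ℕ → (Matrix (Fin (N + 1)) (Fin (N + 1)) ℂ)[X],
      MVOP.IsMonicOrthogonalSeq (MVOP.weight N) P →
        ∀ n : ℕ, MVOP.actRight (P n) (MVOP.opE N) = C (MVOP.eigenvalueE N n) * P n := by
  have hW : Continuous (MVOP.weight N) := continuous_matrix (MVOP.continuous_weight N)
  have main : ∀ (R : ℕ → (Matrix (Fin (N + 1)) (Fin (N + 1)) ℂ)[X]),
      MVOP.IsOrthogonalSeq (MVOP.weight N) R → ∀ (n : ℕ) (Γ : Matrix (Fin (N + 1)) (Fin (N + 1)) ℂ),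
      (R n).leadingCoeff * MVOP.eigenvalueE N n = Γ * (R n).leadingCoeff →
      MVOP.actRight (R n) (MVOP.opE N) = C Γ * R n := by
    intro R hR n Γ hΓ
    refine MVOP.actRight_eq_of_symmetric hW (fun Q hQ => MVOP.eq_zero_of_pairing_self hW
      (fun x hx => MVOP.weight_posDef N hx) hQ) (MVOP.opE_symmetric N hN)
      (MVOP.degree_actRight_opE_lt N) hR ?_
    rw [MVOP.coeff_actRight_opE N _ n (coeff_eq_zero_of_natDegree_lt (by
      rw [hR.natDegree_eq]; omega)), MVOP.eigenvalueE_eq, ← hΓ, leadingCoeff, hR.natDegree_eq]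
  refine ⟨⟨MVOP.opE_mem_opAlgebra N, MVOP.opE_symmetric N hN⟩,
    ⟨MVOP.opE_mem_opAlgebra N, fun R hR => ?_⟩, fun P hP n => ?_⟩
  · choose B hB using fun n => (hR.isUnit_leadingCoeff n).exists_left_inv
    -- For leading coefficient L the eigenvalue is LΛ_nL⁻¹, the conjugate forced by comparing top
    -- coefficients; it reduces to Λ_n in the monic case.
    refine ⟨fun n => (R n).leadingCoeff * MVOP.eigenvalueE N n * B n, fun n => main R hR n _ ?_⟩
    rw [mul_assoc _ (B n), hB, mul_one]
  · refine main P hP.toIsOrthogonalSeq n _ ?_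
    rw [(hP.monic n).leadingCoeff, one_mul, mul_one]
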